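/- Notation. Let $\mathbb D=\{|z|<1\}$, $\mathbb T=\{|z|=1\}$, let $\mathbb E=(\mathbb C\cup\{\infty\})\setminus(\mathbb D\cup\mathbb T)$, and let $m$ be the normalized Lebesgue measure on $\mathbb T$ ($m(\mathbb T)=1$). For $G\in\{\mathbb D,\mathbb E\}$ let $\mathcal{NM}(G)$ be the class of meromorphic functions in $G$ that are quotients of two bounded holomorphic functions in $G$ (with denominator not identically zero). For $h\in\mathcal{NM}(\mathbb D)$ (resp. $\mathcal{NM}(\mathbb E)$) let $\underline h$ be its boundary function: $\underline h(t)=\lim_{r\to1-0}h(rt)$ (resp. $\lim_{r\to1+0}h(rt)$) for $m$-a.e. $t\in\mathbb T$. Let $\Pi(\mathbb D)$ be the set of all $h\in\mathcal{NM}(\mathbb D)$ that admit a pseudocontinuation into $\mathbb E$, i.e. for which there is $h^{\#}\in\mathcal{NM}(\mathbb E)$ with $\underline{h^{\#}}=\underline h$ $m$-a.e. on $\mathbb T$. A Schur function is a holomorphic $\Theta:\mathbb D\to\mathbb C$ with $|\Theta|\le 1$; it is inner if $|\underline\Theta|=1$ $m$-a.e. on $\mathbb T$. Theorem. Let $\Theta$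 be a Schur function that is not inner, and let $\mu$ be the Borel probability measure on $\mathbb T$ associated with $\Theta$, i.e. $$\frac{1+\zeta\Theta(\zeta)}{1-\zeta\Theta(\zeta)}=\int_{\mathbb T}\frac{t+\zeta}{t-\zeta}\,\mu(dt),\qquad \zeta\in\mathbb D.$$ Let $\mu(dt)=w(t)\,m(dt)+\mu_s(dt)$ be the Lebesgue decomposition of $\mu$ with respect to $m$. Then the following are equivalent: (i) $\Theta\in\Pi(\mathbb D)$. (ii) $\mu$ satisfies the Szegő condition, i.e. $\ln w$ is $m$-integrable (with $\ln 0=-\infty$; in particular $w>0$ $m$-a.e.), and the Szegő function of $\mu$, $$D(\zeta)=\exp\left\{\frac12\int_{\mathbb T}\frac{t+\zeta}{t-\zeta}\ln w(t)\,m(dt)\right\},\qquad \zeta\in\mathbb D,$$ belongs to $\Pi(\mathbb D)$. -/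

import Mathlib

open MeasureTheory Filter Topology

noncomputable section

/-- The unit circle carries its Borel `σ`-algebra. -/
instance circleMeasurableSpace : MeasurableSpace Circle := borel Circle

instance circleBorelSpace : BorelSpace Circle := ⟨rfl⟩

namespace Pseudocontinuation

/-- The open unit disk `𝔻`. -/
def disk : Set ℂ := {z | ‖z‖ < 1}

/-- The finite part of the exterior `𝔼` of the closed unit disk in the Riemann sphere. The point
`∞` of `𝔼` is taken care of by conditions at `0` in the local coordinate `w = 1 / z`. -/
def exterior : Set ℂ := {z | 1 < ‖z‖}

/-- The normalized Lebesgue measure `m` on the unit circle (total mass `1`): the image of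
`dθ / (2π)` on `(-π, π]` under `θ ↦ exp (iθ)`. -/
def m : Measure Circle :=
  ((ENNReal.ofReal (2 * Real.pi))⁻¹ •
    (volume : Measure ℝ).restrict (Set.Ioc (-Real.pi) Real.pi)).map Circle.exp

/-- Bounded holomorphic functions on an open set `G ⊆ ℂ`. -/
def BoundedHolomorphicOn (f : ℂ → ℂ) (G : Set ℂ) : Prop :=
  DifferentiableOn ℂ f G ∧ ∃ C : ℝ, ∀ z ∈ G, ‖f z‖ ≤ C

/-- `f`, given near `∞`, is holomorphic at `∞`: with a suitable value `l` at `∞`, the function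
`w ↦ f (1 / w)` is holomorphic at `w = 0`. -/
def HolomorphicAtInfty (f : ℂ → ℂ) : Prop :=
  ∃ l : ℂ, AnalyticAt ℂ (Function.update (fun w : ℂ => f w⁻¹) 0 l) 0

/-- The meromorphic Nevanlinna class of the disk: functions meromorphic in `𝔻` that are the
quotient of two bounded holomorphic functions in `𝔻`, the denominator not vanishing identically.
As usual for `MeromorphicOn`, the values at the (isolated) zeros of the denominator carry no
information. -/
def NMDisk (h : ℂ → ℂ) : Prop :=
  MeromorphicOn h disk ∧
  ∃ f g : ℂ → ℂ, BoundedHolomorphicOn f disk ∧ BoundedHolomorphicOn g disk ∧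
    (∃ z ∈ disk, g z ≠ 0) ∧
    ∀ z ∈ disk, g z ≠ 0 → h z = f z / g z

/-- The meromorphic Nevanlinna class of the exterior `𝔼` (a domain of the Riemann sphere that
contains `∞`): functions meromorphic in `𝔼` that are the quotient of two bounded holomorphic
functions in `𝔼`, the denominator not vanishing identically. -/
def NMExterior (h : ℂ → ℂ) : Prop :=
  MeromorphicOn h exterior ∧ MeromorphicAt (fun w : ℂ => h w⁻¹) 0 ∧
  ∃ f g : ℂ → ℂ,
    BoundedHolomorphicOn f exterior ∧ HolomorphicAtInfty f ∧
    BoundedHolomorphicOn g exterior ∧ HolomorphicAtInfty g ∧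
    (∃ z ∈ exterior, g z ≠ 0) ∧
    ∀ z ∈ exterior, g z ≠ 0 → h z = f z / g z

/-- `b` is a (Borel) boundary function of `h` from inside the disk: `h (r t) → b t` as `r → 1-`,
for `m`-almost every `t`. -/
def IsInnerBoundary (h : ℂ → ℂ) (b : Circle → ℂ) : Prop :=
  Measurable b ∧
    ∀ᵐ t : Circle ∂m, Tendsto (fun r : ℝ => h ((r : ℂ) * (t : ℂ))) (𝓝[<] 1) (𝓝 (b t))

/-- `b` is a (Borel) boundary function of `h` from outside the disk: `h (r t) → b t` as
`r → 1+`, for `m`-almost every `t`. -/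
def IsOuterBoundary (h : ℂ → ℂ) (b : Circle → ℂ) : Prop :=
  Measurable b ∧
    ∀ᵐ t : Circle ∂m, Tendsto (fun r : ℝ => h ((r : ℂ) * (t : ℂ))) (𝓝[>] 1) (𝓝 (b t))

/-- The class `Π(𝔻)`: `h` belongs to the meromorphic Nevanlinna class of the disk and there is a
function `k` in the meromorphic Nevanlinna class of the exterior whose boundary function agrees
`m`-almost everywhere with that of `h`. -/
def Pseudocontinuable (h : ℂ → ℂ) : Prop :=
  NMDisk h ∧ ∃ k : ℂ → ℂ, NMExterior k ∧
    ∃ b c : Circle → ℂ, IsInnerBoundary h b ∧ IsOuterBoundary k c ∧ b =ᵐ[m] c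

/-- Schur functions: holomorphic in the disk and bounded by `1` there. -/
def IsSchur (Θ : ℂ → ℂ) : Prop :=
  DifferentiableOn ℂ Θ disk ∧ ∀ z ∈ disk, ‖Θ z‖ ≤ 1

/-- Inner functions: Schur functions whose boundary function is unimodular `m`-almost
everywhere. -/
def IsInner (Θ : ℂ → ℂ) : Prop :=
  IsSchur Θ ∧ ∃ b : Circle → ℂ, IsInnerBoundary Θ b ∧ ∀ᵐ t ∂m, ‖b t‖ = 1

/-- The probability measure `μ` is associated with `Θ`: it is the Riesz–Herglotz measure of the
normalized Carathéodory function `Φ(ζ) = (1 + ζ Θ(ζ)) / (1 - ζ Θ(ζ))`. -/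
def IsAssociated (Θ : ℂ → ℂ) (μ : Measure Circle) : Prop :=
  IsProbabilityMeasure μ ∧
  ∀ ζ ∈ disk, (1 + ζ * Θ ζ) / (1 - ζ * Θ ζ) = ∫ t : Circle, ((t : ℂ) + ζ) / ((t : ℂ) - ζ) ∂μ

/-- The density `w` of the absolutely continuous part of `μ` with respect to `m`. -/
def density (μ : Measure Circle) (t : Circle) : ℝ := (μ.rnDeriv m t).toReal

/-- The Szegő condition: `ln w` is `m`-integrable. Since `ln 0 = -∞`, this includes `w > 0`
`m`-almost everywhere, which has to be said explicitly because `Real.log 0 = 0`. -/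
def SzegoCondition (μ : Measure Circle) : Prop :=
  (∀ᵐ t ∂m, 0 < density μ t) ∧ Integrable (fun t => Real.log (density μ t)) m

/-- The Szegő function
`D(ζ) = exp ((1/2) ∫ (t + ζ) / (t - ζ) ln w(t) m(dt))` of a measure satisfying the Szegő
condition. -/
def szegoFunction (μ : Measure Circle) (ζ : ℂ) : ℂ :=
  Complex.exp ((1 / 2 : ℂ) *
    ∫ t : Circle, ((t : ℂ) + ζ) / ((t : ℂ) - ζ) * ((Real.log (density μ t) : ℝ) : ℂ) ∂m)

end Pseudocontinuation

end

noncomputable section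

namespace Pseudocontinuation

open Metric Set ComplexConjugate

/-! Let θ and d be the boundary functions of Θ and of the Szegő function D. The map z ↦ 1/conj z
exchanges disk and exterior, so a function of bounded type with boundary function b is
pseudocontinuable exactly when conj b is a.e. a quotient of boundary functions of bounded
holomorphic functions in the disk (`pseudocontinuable_iff`). Modulo null sets such quotients form a
field K (`IsBoundaryQuotient`), which contains t and θ. A nonzero element of K is nonzero a.e. and
has integrable log-modulus (`IsBoundaryQuotient.integrable_log`).

The theorem is then algebra in K. Fatou's theorem applied to the real part of the Carathéodory
function gives w |1 - tθ|² = 1 - |θ|² a.e. (`IsAssociated.ae_density_mul`), that is, w (1 - tθ)(1 -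
t⁻¹ conj θ) = 1 - θ conj θ. If conj θ ∈ K, then 1 - |θ|² lies in K and is not zero because Θ is not
inner. Hence w is a nonzero element of K, which is the Szegő condition, and w = d conj d puts conj d
in K. Conversely, if conj d ∈ K, then w = d conj d ∈ K, and the identity, being linear in conj θ,
can be solved for conj θ inside K.

The analytic input is Fatou's theorem for Poisson integrals of measures, Herglotz' theorem (whence
radial limits of bounded functions), and Jensen's formula with Fatou's lemma (whence
log-integrability). -/

/-! ### The measure `m` on the circle: arc estimates and differentiation of measures -/

lemma ofReal_two_pi_ne_zero : ENNReal.ofReal (2 * Real.pi) ≠ 0 := by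
  simp [Real.pi_pos]

lemma m_apply {S : Set Circle} (hS : MeasurableSet S) :
    m S = (ENNReal.ofReal (2 * Real.pi))⁻¹ *
      volume (Circle.exp ⁻¹' S ∩ Ioc (-Real.pi) Real.pi) := by
  have hexp : Measurable (Circle.exp : ℝ → Circle) := Circle.exp.continuous.measurable
  rw [m, Measure.map_apply hexp hS, Measure.smul_apply, Measure.restrict_apply (hexp hS),
    smul_eq_mul]

instance isProbabilityMeasure_m : IsProbabilityMeasure m := by
  constructor
  rw [m_apply MeasurableSet.univ, preimage_univ, univ_inter, Real.volume_Ioc,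
    show Real.pi - -Real.pi = 2 * Real.pi by ring]
  exact ENNReal.inv_mul_cancel ofReal_two_pi_ne_zero ENNReal.ofReal_ne_top

instance nullSingletonClass_m : NullSingletonClass m := by
  constructor
  intro t
  rw [m_apply (measurableSet_singleton t)]
  have : Circle.exp ⁻¹' {t} ∩ Ioc (-Real.pi) Real.pi ⊆ {Complex.arg t} := by
    rintro θ ⟨h1, h2⟩
    have h1 : Circle.exp θ = t := h1
    rw [mem_singleton_iff, ← h1, Circle.arg_exp h2.1 h2.2]
  rw [measure_mono_null this (by simp), mul_zero]

/-- Bridge to `Real.circleAverage`, the form in which the Poisson and Jensen formulas are used. The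
shift by -π reconciles the parameter intervals (-π, π] and (0, 2π]. -/
lemma integral_m {E : Type*} [NormedAddCommGroup E] [NormedSpace ℝ E] {f : ℂ → E} {r : ℝ}
    (hf : AEStronglyMeasurable (fun t : Circle => f (r * t)) m) :
    ∫ t : Circle, f (r * t) ∂m = Real.circleAverage f 0 r := by
  have hexp : Measurable (Circle.exp : ℝ → Circle) := Circle.exp.continuous.measurable
  rw [m] at hf ⊢
  rw [integral_map hexp.aemeasurable hf, integral_smul_measure,
    Real.circleAverage_eq_integral_add (-Real.pi),
    intervalIntegral.integral_of_le (by linarith [Real.pi_pos])]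
  have h1 : (fun θ : ℝ => f (r * (Circle.exp θ : ℂ))) = fun θ => f (circleMap 0 r θ) := by
    funext θ; simp [circleMap]
  rw [h1]
  have h2 : ∀ g : ℝ → E, ∫ x in Ioc 0 (2 * Real.pi), g (x + -Real.pi) =
      ∫ x in Ioc (-Real.pi) Real.pi, g x := by
    intro g
    rw [← intervalIntegral.integral_of_le (by linarith [Real.pi_pos]),
      ← intervalIntegral.integral_of_le (by linarith [Real.pi_pos]),
      intervalIntegral.integral_comp_add_right]
    congr 1 <;> ring
  rw [h2 (fun θ => f (circleMap 0 r θ)), ENNReal.toReal_inv,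
    ENNReal.toReal_ofReal (by positivity)]

lemma circleIntegrable_iff {E : Type*} [NormedAddCommGroup E] {f : ℂ → E} {r : ℝ}
    (hf : AEStronglyMeasurable (fun t : Circle => f (r * t)) m) (h : CircleIntegrable f 0 r) :
    Integrable (fun t : Circle => f (r * t)) m := by
  have hexp : Measurable (Circle.exp : ℝ → Circle) := Circle.exp.continuous.measurable
  rw [m] at hf ⊢
  rw [integrable_map_measure hf hexp.aemeasurable]
  refine Integrable.smul_measure ?_ (by simp [Real.pi_pos])
  have h1 : (fun t : Circle => f (r * t)) ∘ Circle.exp = fun θ => f (circleMap 0 r θ) := by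
    funext θ; simp [circleMap]
  rw [h1]
  have h2 : Function.Periodic (fun θ => f (circleMap 0 r θ)) (2 * Real.pi) := fun θ => by
    simp [periodic_circleMap 0 r θ]
  have h3 := h2.intervalIntegrable₀ (by positivity) h (-Real.pi) Real.pi
  exact (intervalIntegrable_iff_integrableOn_Ioc_of_le (by linarith [Real.pi_pos])).1 h3

lemma dist_circle (s t : Circle) : dist s t = ‖(s : ℂ) - t‖ :=
  dist_eq_norm (s : ℂ) t

lemma dist_exp (a b : ℝ) : dist (Circle.exp a) (Circle.exp b) = 2 * |Real.sin ((a - b) / 2)| := by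
  rw [dist_circle]
  have h : (Circle.exp a : ℂ) - Circle.exp b
      = (Circle.exp b : ℂ) * (Complex.exp (Complex.I * (a - b : ℝ)) - 1) := by
    rw [Circle.coe_exp, Circle.coe_exp, mul_sub, ← Complex.exp_add]
    congr 1
    · congr 1; push_cast; ring
    · simp
  rw [h, norm_mul, Circle.norm_coe, one_mul, Complex.norm_exp_I_mul_ofReal_sub_one]
  simp

/-- A chord has length 2 |sin (x / 2)|, and |sin y| ≥ (2 / π) |y| for |y| ≤ π / 2. The two
translates by 2π catch arcs that cross the cut at -1. -/
lemma exp_preimage_closedBall_subset {t : Circle} {ε : ℝ} :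
    Circle.exp ⁻¹' closedBall t (2 * ε) ∩ Ioc (-Real.pi) Real.pi ⊆
      closedBall (Complex.arg t) (Real.pi * ε) ∪
        (closedBall (Complex.arg t + 2 * Real.pi) (Real.pi * ε) ∪ closedBall (Complex.arg t - 2 * Real.pi) (Real.pi * ε)) := by
  rintro θ ⟨h1, h2, h3⟩
  obtain ⟨h4, h5⟩ := Complex.arg_mem_Ioc (t : ℂ)
  rw [mem_preimage, mem_closedBall] at h1
  nth_rw 1 [← Circle.exp_arg t] at h1
  rw [dist_exp] at h1
  have hpi := Real.pi_pos
  set a := Complex.arg t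
  have key : ∀ y : ℝ, |y| ≤ Real.pi / 2 → |Real.sin y| ≤ ε → |y| * 2 ≤ Real.pi * ε := by
    intro y hy hs
    have := (Real.mul_abs_le_abs_sin hy).trans hs
    rw [div_mul_eq_mul_div, div_le_iff₀ hpi] at this
    linarith
  have hs : |Real.sin ((θ - a) / 2)| ≤ ε := by linarith
  simp only [mem_union, mem_closedBall, Real.dist_eq]
  rcases le_or_gt |(θ - a) / 2| (Real.pi / 2) with h | h
  · left
    have := key _ h hs
    rwa [abs_div, abs_two, div_mul_cancel₀ _ two_ne_zero] at this
  · right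
    rcases lt_abs.1 h with h | h
    · left
      have h6 := key ((θ - a) / 2 - Real.pi) (abs_le.2 ⟨by linarith, by linarith⟩)
        (by rwa [Real.sin_sub_pi, abs_neg])
      rw [show (θ - a) / 2 - Real.pi = (θ - (a + 2 * Real.pi)) / 2 by ring, abs_div, abs_two,
        div_mul_cancel₀ _ two_ne_zero] at h6
      exact h6
    · right
      have h6 := key ((θ - a) / 2 + Real.pi) (abs_le.2 ⟨by linarith, by linarith⟩)
        (by rwa [Real.sin_add_pi, abs_neg])
      rw [show (θ - a) / 2 + Real.pi = (θ - (a - 2 * Real.pi)) / 2 by ring, abs_div, abs_two,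
        div_mul_cancel₀ _ two_ne_zero] at h6
      exact h6

lemma volume_exp_preimage_closedBall_le (t : Circle) (ε : ℝ) :
    volume (Circle.exp ⁻¹' closedBall t (2 * ε) ∩ Ioc (-Real.pi) Real.pi) ≤
      ENNReal.ofReal (6 * Real.pi * ε) := by
  refine (measure_mono exp_preimage_closedBall_subset).trans ((measure_union_le _ _).trans
    ((add_le_add_right (measure_union_le _ _) _).trans ?_))
  rw [Real.volume_closedBall, Real.volume_closedBall, Real.volume_closedBall]
  rcases le_or_gt 0 ε with h | h
  · have := Real.pi_pos
    rw [← ENNReal.ofReal_add (by positivity) (by positivity),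
      ← ENNReal.ofReal_add (by positivity) (by positivity)]
    exact ENNReal.ofReal_le_ofReal (by linarith)
  · have : 2 * (Real.pi * ε) ≤ 0 := by nlinarith [Real.pi_pos]
    simp [ENNReal.ofReal_of_nonpos this]

/-- Chords are shorter than arcs. Taking the one-sided interval of length ε that starts at arg t and
points across 0, away from the nearer end, keeps it inside (-π, π]. -/
lemma le_volume_exp_preimage_closedBall (t : Circle) {ε : ℝ} (hε : ε ≤ Real.pi) :
    ENNReal.ofReal ε ≤ volume (Circle.exp ⁻¹' closedBall t ε ∩ Ioc (-Real.pi) Real.pi) := by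
  obtain ⟨h4, h5⟩ := Complex.arg_mem_Ioc (t : ℂ)
  have hd : ∀ θ : ℝ, |θ - Complex.arg t| ≤ ε → θ ∈ Circle.exp ⁻¹' closedBall t ε := by
    intro θ h
    rw [mem_preimage, mem_closedBall]
    nth_rw 1 [← Circle.exp_arg t]
    rw [dist_exp]
    have := Real.abs_sin_le_abs (x := (θ - Complex.arg t) / 2)
    rw [abs_div, abs_two] at this
    linarith
  set a := Complex.arg t
  rcases le_or_gt a 0 with h | h
  · have hsub : Ioc a (a + ε) ⊆ Circle.exp ⁻¹' closedBall t ε ∩ Ioc (-Real.pi) Real.pi :=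
      fun θ hθ => ⟨hd θ (abs_le.2 ⟨by linarith [hθ.1, hθ.2], by linarith [hθ.2]⟩),
        by linarith [hθ.1], by linarith [hθ.2]⟩
    refine le_trans (le_of_eq ?_) (measure_mono hsub)
    rw [Real.volume_Ioc, add_sub_cancel_left]
  · have hsub : Ioc (a - ε) a ⊆ Circle.exp ⁻¹' closedBall t ε ∩ Ioc (-Real.pi) Real.pi :=
      fun θ hθ => ⟨hd θ (abs_le.2 ⟨by linarith [hθ.1], by linarith [hθ.1, hθ.2]⟩),
        by linarith [hθ.1], by linarith [hθ.2]⟩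
    refine le_trans (le_of_eq ?_) (measure_mono hsub)
    rw [Real.volume_Ioc, sub_sub_cancel]

instance isUnifLocDoublingMeasure_m : IsUnifLocDoublingMeasure m := by
  -- 6π is the ratio of the upper bound 6πε at radius 2ε to the lower bound ε at radius ε.
  refine ⟨⟨Real.toNNReal (6 * Real.pi), ?_⟩⟩
  have : ∀ᶠ ε : ℝ in 𝓝[>] 0, ε ≤ Real.pi :=
    mem_nhdsWithin_of_mem_nhds (Iic_mem_nhds Real.pi_pos)
  filter_upwards [this] with ε hε t
  rw [m_apply measurableSet_closedBall, m_apply measurableSet_closedBall, mul_left_comm]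
  refine mul_le_mul_right ((volume_exp_preimage_closedBall_le t ε).trans ?_) _
  rw [ENNReal.ofReal_mul (by positivity)]
  exact mul_le_mul_right (le_volume_exp_preimage_closedBall t hε) _

lemma ae_tendsto_measure_closedBall_div (ν : Measure Circle) [IsFiniteMeasure ν] :
    ∀ᵐ t ∂m, Tendsto (fun ρ => ν (closedBall t ρ) / m (closedBall t ρ)) (𝓝[>] 0)
      (𝓝 (ν.rnDeriv m t)) := by
  filter_upwards [(IsUnifLocDoublingMeasure.vitaliFamily m 1).ae_tendsto_rnDeriv ν] with t ht
  refine ht.comp (IsUnifLocDoublingMeasure.tendsto_closedBall_filterAt m (fun _ => t) id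
    tendsto_id ?_)
  filter_upwards [self_mem_nhdsWithin] with ρ hρ
  exact mem_closedBall_self (by simpa using le_of_lt hρ)

lemma m_closedBall_pos (t : Circle) {ρ : ℝ} (hρ : 0 < ρ) : 0 < m (closedBall t ρ) := by
  have h1 : 0 < m (closedBall t (min ρ Real.pi)) := by
    rw [m_apply measurableSet_closedBall]
    refine ENNReal.mul_pos (by simp [ENNReal.mul_eq_top]) (ne_of_gt ?_)
    exact lt_of_lt_of_le (ENNReal.ofReal_pos.2 (lt_min hρ Real.pi_pos))
      (le_volume_exp_preimage_closedBall t (min_le_right _ _))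
  exact h1.trans_le (measure_mono (closedBall_subset_closedBall (min_le_left _ _)))

/-! ### The Poisson kernel and Fatou's theorem -/

/-- For unimodular s and t, |s - rt|² = (1 - r)² + r |s - t|². The kernel thus decreases with the
distance, so its superlevel sets are balls about t. -/
lemma poissonKernel_circle (r : ℝ) (s t : Circle) :
    poissonKernel 0 (r * t) s = (1 - r ^ 2) / ((1 - r) ^ 2 + r * dist s t ^ 2) := by
  rw [poissonKernel, dist_circle]
  simp only [sub_zero, Circle.norm_coe, norm_mul, mul_one, Complex.norm_real, Real.norm_eq_abs,
    sq_abs, one_pow]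
  congr 1
  have hs : (s : ℂ).re * (s : ℂ).re + (s : ℂ).im * (s : ℂ).im = 1 := by
    rw [← Complex.normSq_apply, Circle.normSq_coe]
  have ht : (t : ℂ).re * (t : ℂ).re + (t : ℂ).im * (t : ℂ).im = 1 := by
    rw [← Complex.normSq_apply, Circle.normSq_coe]
  rw [← Complex.normSq_eq_norm_sq, ← Complex.normSq_eq_norm_sq, Complex.normSq_apply,
    Complex.normSq_apply]
  simp only [Complex.sub_re, Complex.sub_im, Complex.mul_re, Complex.mul_im, Complex.ofReal_re,
    Complex.ofReal_im, zero_mul, sub_zero, add_zero]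
  linear_combination (1 - r) * hs + (r ^ 2 - r) * ht

lemma poissonKernel_circle_pos {r : ℝ} (h0 : 0 < r) (h1 : r < 1) (s t : Circle) :
    0 < poissonKernel 0 (r * t) s := by
  rw [poissonKernel_circle]
  have : 0 < 1 - r ^ 2 := by nlinarith
  have : 0 < (1 - r) ^ 2 := by nlinarith
  positivity

lemma norm_lt_one_of_mul {r : ℝ} (h0 : 0 < r) (h1 : r < 1) (t : Circle) : ‖(r : ℂ) * t‖ < 1 := by
  rwa [norm_mul, Circle.norm_coe, mul_one, Complex.norm_real, Real.norm_eq_abs, abs_of_pos h0]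

lemma sub_ne_zero_of_disk {z : ℂ} (hz : ‖z‖ < 1) (s : Circle) : (s : ℂ) - z ≠ 0 := by
  intro h
  rw [sub_eq_zero] at h
  rw [← h, Circle.norm_coe] at hz
  exact lt_irrefl _ hz

lemma continuous_poissonKernel {z : ℂ} (hz : ‖z‖ < 1) :
    Continuous (fun s : Circle => poissonKernel 0 z s) := by
  unfold poissonKernel
  refine Continuous.div (by fun_prop) (by fun_prop) fun s => ?_
  simpa using sub_ne_zero_of_disk hz s

lemma le_poissonKernel_iff {r σ : ℝ} (h0 : 0 < r) (h1 : r < 1) (hσ : 0 < σ) (s t : Circle) :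
    σ ≤ poissonKernel 0 (r * t) s ↔ dist s t ^ 2 ≤ ((1 - r ^ 2) / σ - (1 - r) ^ 2) / r := by
  have : 0 < (1 - r) ^ 2 := by nlinarith
  rw [poissonKernel_circle, le_div_iff₀ (by positivity), le_div_iff₀ h0,
    le_sub_iff_add_le (c := (1 - r ^ 2) / σ), le_div_iff₀ hσ, mul_comm σ, mul_comm _ r, add_comm]

/-- Layer-cake formula: the integral over the ball is an integral of measures of superlevel sets,
each a smaller ball about t, so a comparison on balls passes to Poisson integrals. -/
lemma lintegral_poissonKernel_closedBall_le {ν₁ ν₂ : Measure Circle} {t : Circle} {δ r : ℝ}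
    (hδ : 0 < δ) (h0 : 0 < r) (h1 : r < 1)
    (h : ∀ ρ, 0 < ρ → ρ ≤ δ → ν₁ (closedBall t ρ) ≤ ν₂ (closedBall t ρ)) :
    ∫⁻ s in closedBall t δ, ENNReal.ofReal (poissonKernel 0 (r * t) s) ∂ν₁ ≤
      ∫⁻ s in closedBall t δ, ENNReal.ofReal (poissonKernel 0 (r * t) s) ∂ν₂ := by
  have hm : Measurable (fun s : Circle => poissonKernel 0 (r * t) s) :=
    (continuous_poissonKernel (norm_lt_one_of_mul h0 h1 t)).measurable
  have hpos := fun s => (poissonKernel_circle_pos h0 h1 s t).le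
  rw [lintegral_eq_lintegral_meas_le _ (Eventually.of_forall hpos) hm.aemeasurable,
    lintegral_eq_lintegral_meas_le _ (Eventually.of_forall hpos) hm.aemeasurable]
  refine lintegral_mono_ae ?_
  -- At this single level, the maximum of the kernel, the superlevel set is the point {t}, to which
  -- the hypothesis on balls of positive radius does not apply.
  have hne : ∀ᵐ σ : ℝ, σ ≠ (1 - r ^ 2) / (1 - r) ^ 2 := by simp [ae_iff]
  filter_upwards [ae_restrict_of_ae hne, ae_restrict_mem measurableSet_Ioi] with σ hσ hσ0
  have hσ0 : 0 < σ := hσ0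
  have hms : MeasurableSet {s : Circle | σ ≤ poissonKernel 0 (r * t) s} :=
    measurableSet_le measurable_const hm
  rw [Measure.restrict_apply hms, Measure.restrict_apply hms]
  set q := ((1 - r ^ 2) / σ - (1 - r) ^ 2) / r with hq
  have hset : {s : Circle | σ ≤ poissonKernel 0 (r * t) s} = {s | dist s t ^ 2 ≤ q} := by
    ext s; exact le_poissonKernel_iff h0 h1 hσ0 s t
  rw [hset]
  rcases lt_trichotomy q 0 with hlt | heq | hgt
  · have : {s : Circle | dist s t ^ 2 ≤ q} = ∅ := by
      ext s
      simp only [mem_ofPred_eq, mem_empty_iff_false, iff_false, not_le]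
      exact hlt.trans_le (sq_nonneg _)
    simp [this]
  · exfalso
    apply hσ
    rw [hq, div_eq_zero_iff, or_iff_left h0.ne', sub_eq_zero] at heq
    have : 0 < (1 - r) ^ 2 := by nlinarith
    rw [← heq]
    have : 0 < 1 - r ^ 2 := by nlinarith
    field_simp
  · have : {s : Circle | dist s t ^ 2 ≤ q} ∩ closedBall t δ = closedBall t (min (√q) δ) := by
      ext s
      simp only [mem_inter_iff, mem_ofPred_eq, mem_closedBall, le_min_iff]
      rw [Real.le_sqrt dist_nonneg hgt.le]
    rw [this]
    exact h _ (lt_min (Real.sqrt_pos.2 hgt) hδ) (min_le_right _ _)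

lemma tendsto_lintegral_poissonKernel_compl_closedBall (ν : Measure Circle) [IsFiniteMeasure ν]
    (t : Circle) {δ : ℝ} (hδ : 0 < δ) :
    Tendsto (fun r : ℝ => ∫⁻ s in (closedBall t δ)ᶜ,
      ENNReal.ofReal (poissonKernel 0 (r * t) s) ∂ν) (𝓝[<] 1) (𝓝 0) := by
  have hlim : Tendsto (fun r : ℝ => ENNReal.ofReal ((1 - r ^ 2) / (r * δ ^ 2)) * ν univ) (𝓝[<] 1)
      (𝓝 0) := by
    have h1 : Tendsto (fun r : ℝ => (1 - r ^ 2) / (r * δ ^ 2)) (𝓝[<] 1) (𝓝 0) := by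
      have : ContinuousAt (fun r : ℝ => (1 - r ^ 2) / (r * δ ^ 2)) 1 := by
        refine ContinuousAt.div (by fun_prop) (by fun_prop) (by positivity)
      have h2 := this.tendsto.mono_left (nhdsWithin_le_nhds (s := Iio 1))
      simpa using h2
    have h2 := ENNReal.Tendsto.mul_const (ENNReal.tendsto_ofReal h1)
      (Or.inr (measure_ne_top ν univ))
    simpa using h2
  refine tendsto_of_tendsto_of_tendsto_of_le_of_le' tendsto_const_nhds hlim
    (Eventually.of_forall fun _ => zero_le) ?_
  filter_upwards [Ioo_mem_nhdsLT (show (0 : ℝ) < 1 by norm_num)] with r hr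
  calc _ ≤ ∫⁻ s in (closedBall t δ)ᶜ, ENNReal.ofReal ((1 - r ^ 2) / (r * δ ^ 2)) ∂ν := by
        refine setLIntegral_mono measurable_const fun s hs => ENNReal.ofReal_le_ofReal ?_
        rw [mem_compl_iff, mem_closedBall, not_le] at hs
        rw [poissonKernel_circle]
        have h0 := hr.1
        have : 0 ≤ 1 - r ^ 2 := by nlinarith [hr.1, hr.2]
        gcongr
        nlinarith [sq_nonneg (1 - r), mul_le_mul_of_nonneg_left
          (pow_le_pow_left₀ hδ.le hs.le 2) h0.le]
    _ ≤ _ := by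
        rw [setLIntegral_const]
        exact mul_le_mul_right (measure_mono (subset_univ _)) _

lemma integral_poissonKernel_mul_of_diffContOnCl {f : ℂ → ℂ} (hf : DiffContOnCl ℂ f (ball 0 1))
    (hf' : Continuous fun s : Circle => f s) {z : ℂ} (hz : ‖z‖ < 1) :
    ∫ s : Circle, (poissonKernel 0 z s : ℂ) * f s ∂m = f z := by
  have h := hf.circleAverage_poissonKernel_smul (w := z) (by simpa using hz)
  have h2 := integral_m (f := poissonKernel 0 z • f) (r := 1) (by
    refine Continuous.aestronglyMeasurable ?_
    simp only [Complex.ofReal_one, one_mul, Pi.smul_apply']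
    exact (continuous_poissonKernel hz).smul hf')
  rw [h] at h2
  simpa using h2

lemma integral_poissonKernel_m {z : ℂ} (hz : ‖z‖ < 1) :
    ∫ s : Circle, poissonKernel 0 z s ∂m = 1 := by
  have h := integral_poissonKernel_mul_of_diffContOnCl (f := fun _ => 1) diffContOnCl_const
    continuous_const hz
  simp only [mul_one] at h
  rw [integral_complex_ofReal] at h
  exact_mod_cast h

lemma integrable_poissonKernel (ν : Measure Circle) [IsFiniteMeasure ν] {z : ℂ} (hz : ‖z‖ < 1) :
    Integrable (fun s : Circle => poissonKernel 0 z s) ν :=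
  (continuous_poissonKernel hz).integrable_of_hasCompactSupport
    (HasCompactSupport.of_compactSpace _)

lemma lintegral_poissonKernel (ν : Measure Circle) [IsFiniteMeasure ν] {r : ℝ} (h0 : 0 < r)
    (h1 : r < 1) (t : Circle) :
    ∫⁻ s, ENNReal.ofReal (poissonKernel 0 (r * t) s) ∂ν =
      ENNReal.ofReal (∫ s : Circle, poissonKernel 0 (r * t) s ∂ν) :=
  (ofReal_integral_eq_lintegral_ofReal (integrable_poissonKernel ν (norm_lt_one_of_mul h0 h1 t))
    (Eventually.of_forall fun s => (poissonKernel_circle_pos h0 h1 s t).le)).symm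

/-- For a' < w < b', the measure ν lies between a' m and b' m on small balls about t. The comparison
lemma handles a fixed ball, the complement contributes nothing in the limit, and the Poisson
integral of `m` is 1. -/
lemma tendsto_lintegral_poissonKernel {ν : Measure Circle} [IsFiniteMeasure ν] {t : Circle}
    {w : ENNReal}
    (h : Tendsto (fun ρ => ν (closedBall t ρ) / m (closedBall t ρ)) (𝓝[>] 0) (𝓝 w)) :
    Tendsto (fun r : ℝ => ∫⁻ s, ENNReal.ofReal (poissonKernel 0 (r * t) s) ∂ν) (𝓝[<] 1) (𝓝 w) := by
  have hI : ∀ᶠ r : ℝ in 𝓝[<] 1, 0 < r ∧ r < 1 := Ioo_mem_nhdsLT (by norm_num)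
  have hm1 : ∀ᶠ r : ℝ in 𝓝[<] 1, ∫⁻ s, ENNReal.ofReal (poissonKernel 0 (r * t) s) ∂m = 1 := by
    filter_upwards [hI] with r hr
    rw [lintegral_poissonKernel m hr.1 hr.2,
      integral_poissonKernel_m (norm_lt_one_of_mul hr.1 hr.2 t), ENNReal.ofReal_one]
  have hsplit : ∀ (ν' : Measure Circle) (δ r : ℝ),
      ∫⁻ s, ENNReal.ofReal (poissonKernel 0 (r * t) s) ∂ν' =
      ∫⁻ s in closedBall t δ, ENNReal.ofReal (poissonKernel 0 (r * t) s) ∂ν' +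
      ∫⁻ s in (closedBall t δ)ᶜ, ENNReal.ofReal (poissonKernel 0 (r * t) s) ∂ν' :=
    fun ν' δ r => (lintegral_add_compl _ measurableSet_closedBall).symm
  refine tendsto_order.2 ⟨fun a ha => ?_, fun b hb => ?_⟩
  · obtain ⟨a', h1, h2⟩ := exists_between ha
    have ha' : a' ≠ ⊤ := h2.ne_top
    obtain ⟨δ, hδ, hsub⟩ := mem_nhdsGT_iff_exists_Ioc_subset.1 (h (Ioi_mem_nhds h2))
    have hT := tendsto_lintegral_poissonKernel_compl_closedBall m t hδ
    have hlim : Tendsto (fun r : ℝ => a' * (1 - ∫⁻ s in (closedBall t δ)ᶜ,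
        ENNReal.ofReal (poissonKernel 0 (r * t) s) ∂m)) (𝓝[<] 1) (𝓝 a') := by
      have := ENNReal.Tendsto.const_mul (ENNReal.Tendsto.sub (tendsto_const_nhds (x := 1)) hT
        (Or.inl ENNReal.one_ne_top)) (Or.inr ha')
      simpa using this
    filter_upwards [hI, hm1, hlim (Ioi_mem_nhds h1)] with r hr hr1 hra
    refine lt_of_lt_of_le hra ?_
    rw [hsplit ν δ]
    refine le_trans ?_ le_self_add
    have key := lintegral_poissonKernel_closedBall_le (ν₁ := a' • m) (ν₂ := ν) (t := t) hδ hr.1 hr.2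
      (by
        intro ρ h3 h4
        have h5 : a' < ν (closedBall t ρ) / m (closedBall t ρ) := hsub ⟨h3, h4⟩
        simpa using ENNReal.mul_le_of_le_div h5.le)
    refine le_trans ?_ key
    rw [Measure.restrict_smul, lintegral_smul_measure, smul_eq_mul]
    refine mul_le_mul_right ?_ _
    rw [tsub_le_iff_right, ← hsplit m δ, hr1]
  · obtain ⟨b', h1, h2⟩ := exists_between hb
    obtain ⟨δ, hδ, hsub⟩ := mem_nhdsGT_iff_exists_Ioc_subset.1 (h (Iio_mem_nhds h1))
    have hT := tendsto_lintegral_poissonKernel_compl_closedBall ν t hδ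
    have hlim : Tendsto (fun r : ℝ => b' + (∫⁻ s in (closedBall t δ)ᶜ,
        ENNReal.ofReal (poissonKernel 0 (r * t) s) ∂ν)) (𝓝[<] 1) (𝓝 b') := by
      simpa using (tendsto_const_nhds (x := b')).add hT
    filter_upwards [hI, hm1, hlim (Iio_mem_nhds h2)] with r hr hr1 hra
    refine lt_of_le_of_lt ?_ hra
    rw [hsplit ν δ]
    refine add_le_add_left ?_ _
    have key := lintegral_poissonKernel_closedBall_le (ν₁ := ν) (ν₂ := b' • m) (t := t) hδ hr.1 hr.2
      (by
        intro ρ h3 h4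
        have h5 : ν (closedBall t ρ) / m (closedBall t ρ) < b' := hsub ⟨h3, h4⟩
        rw [Measure.smul_apply, smul_eq_mul]
        exact (ENNReal.div_le_iff (m_closedBall_pos t h3).ne' (measure_ne_top _ _)).1 h5.le)
    refine key.trans ?_
    rw [Measure.restrict_smul, lintegral_smul_measure, smul_eq_mul]
    calc _ ≤ b' * 1 := mul_le_mul_right (by rw [← hr1, hsplit m δ]; exact le_self_add) _
      _ = b' := mul_one _

/-- **Fatou's theorem**: the Poisson integral of a finite measure on the circle converges radially
to the density of the measure, almost everywhere. -/
theorem ae_tendsto_integral_poissonKernel (ν : Measure Circle) [IsFiniteMeasure ν] :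
    ∀ᵐ t : Circle ∂m, Tendsto (fun r : ℝ => ∫ s : Circle, poissonKernel 0 (r * t) s ∂ν) (𝓝[<] 1)
      (𝓝 (ν.rnDeriv m t).toReal) := by
  filter_upwards [ae_tendsto_measure_closedBall_div ν, ν.rnDeriv_lt_top m] with t ht hw
  have h := (ENNReal.tendsto_toReal hw.ne).comp (tendsto_lintegral_poissonKernel ht)
  refine h.congr' ?_
  filter_upwards [Ioo_mem_nhdsLT (show (0 : ℝ) < 1 by norm_num)] with r hr
  rw [Function.comp_apply, lintegral_poissonKernel ν hr.1 hr.2, ENNReal.toReal_ofReal]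
  exact integral_nonneg fun s => (poissonKernel_circle_pos hr.1 hr.2 s t).le

/-! ### Herglotz' theorem and radial limits of bounded functions -/

lemma disk_eq_ball : disk = ball 0 1 := by
  ext z; simp [disk]

lemma isOpen_disk : IsOpen disk := disk_eq_ball ▸ isOpen_ball

lemma zero_mem_disk : (0 : ℂ) ∈ disk := by simp [disk]

lemma mul_mem_disk {r : ℝ} (h0 : 0 < r) (h1 : r < 1) {z : ℂ} (hz : ‖z‖ ≤ 1) :
    (r : ℂ) * z ∈ disk := by
  rw [disk, mem_ofPred_eq, norm_mul, Complex.norm_real, Real.norm_eq_abs, abs_of_pos h0]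
  nlinarith [norm_nonneg z]

lemma mul_circle_mem_disk {r : ℝ} (h0 : 0 < r) (h1 : r < 1) (t : Circle) : (r : ℂ) * t ∈ disk :=
  mul_mem_disk h0 h1 (Circle.norm_coe t).le

lemma eventually_mem_Ioo : ∀ᶠ r : ℝ in 𝓝[<] 1, 0 < r ∧ r < 1 := Ioo_mem_nhdsLT (by norm_num)

lemma tendsto_mul_nhdsLT (z : ℂ) : Tendsto (fun r : ℝ => (r : ℂ) * z) (𝓝[<] 1) (𝓝 z) := by
  have : Continuous fun r : ℝ => (r : ℂ) * z := by fun_prop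
  simpa using (this.tendsto 1).mono_left nhdsWithin_le_nhds

lemma _root_.DifferentiableOn.continuous_circle {f : ℂ → ℂ} (hf : DifferentiableOn ℂ f disk)
    {r : ℝ} (h0 : 0 < r) (h1 : r < 1) : Continuous fun t : Circle => f (r * t) :=
  hf.continuousOn.comp_continuous (by fun_prop) (mul_circle_mem_disk h0 h1)

lemma integral_poissonKernel_mul {f : ℂ → ℂ} (hf : DifferentiableOn ℂ f disk)
    {r : ℝ} (h0 : 0 < r) (h1 : r < 1) {z : ℂ} (hz : ‖z‖ < 1) :
    ∫ s : Circle, poissonKernel 0 z s * (f (r * s)).re ∂m = (f (r * z)).re := by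
  have hd : DiffContOnCl ℂ (fun w => f (r * w)) (ball 0 1) := by
    refine DifferentiableOn.diffContOnCl ?_
    rw [closure_ball _ one_ne_zero]
    exact hf.comp (by fun_prop) fun w hw => mul_mem_disk h0 h1 (by simpa using hw)
  have hc := hf.continuous_circle h0 h1
  have h := integral_poissonKernel_mul_of_diffContOnCl hd hc hz
  have hi : Integrable (fun s : Circle => (poissonKernel 0 z s : ℂ) * f (r * s)) m :=
    ((Complex.continuous_ofReal.comp (continuous_poissonKernel hz)).mul
      hc).integrable_of_hasCompactSupport (HasCompactSupport.of_compactSpace _)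
  rw [← h, ← Complex.reCLM_apply, ← Complex.reCLM.integral_comp_comm hi]
  simp

lemma exists_seq_tendsto_nhdsLT :
    ∃ u : ℕ → ℝ, (∀ n, 1 / 2 ≤ u n ∧ u n < 1) ∧ Tendsto u atTop (𝓝[<] 1) := by
  obtain ⟨u, -, h1, h2⟩ := exists_seq_strictMono_tendsto' (show (1 / 2 : ℝ) < 1 by norm_num)
  exact ⟨u, fun n => ⟨(h1 n).1.le, (h1 n).2⟩,
    tendsto_nhdsWithin_iff.2 ⟨h2, Eventually.of_forall fun n => (h1 n).2⟩⟩

/-- **Herglotz' theorem**. -/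
theorem exists_probabilityMeasure_of_re_pos {f : ℂ → ℂ} (hf : DifferentiableOn ℂ f disk)
    (hpos : ∀ z ∈ disk, 0 < (f z).re) (hf0 : (f 0).re = 1) :
    ∃ μ : Measure Circle, IsProbabilityMeasure μ ∧
      ∀ z ∈ disk, ∫ s : Circle, poissonKernel 0 z s ∂μ = (f z).re := by
  obtain ⟨r, hr, hrlim'⟩ := exists_seq_tendsto_nhdsLT
  have hr0 : ∀ n, 0 < r n := fun n => by linarith [(hr n).1]
  have hr1 : ∀ n, r n < 1 := fun n => (hr n).2
  have hc : ∀ n, Continuous fun t : Circle => (f (r n * t)).re := fun n =>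
    Complex.continuous_re.comp (hf.continuous_circle (hr0 n) (hr1 n))
  have hp : ∀ n (t : Circle), 0 < (f (r n * t)).re := fun n t =>
    hpos _ (mul_circle_mem_disk (hr0 n) (hr1 n) t)
  let p : ℕ → Measure Circle := fun n => m.withDensity fun t => ENNReal.ofReal (f (r n * t)).re
  have hint : ∀ n (z : ℂ), ‖z‖ < 1 → ∫ s : Circle, poissonKernel 0 z s ∂(p n) = (f (r n * z)).re := by
    intro n z hz
    rw [integral_withDensity_eq_integral_toReal_smul (hc n).measurable.ennreal_ofReal
      (Eventually.of_forall fun _ => ENNReal.ofReal_lt_top),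
      ← integral_poissonKernel_mul hf (hr0 n) (hr1 n) hz]
    refine integral_congr_ae (Eventually.of_forall fun s => ?_)
    simp only [ENNReal.toReal_ofReal (hp n s).le, smul_eq_mul]
    exact mul_comm _ _
  have hprob : ∀ n, IsProbabilityMeasure (p n) := by
    intro n
    constructor
    rw [withDensity_apply _ MeasurableSet.univ, Measure.restrict_univ,
      ← ofReal_integral_eq_lintegral_ofReal ((hc n).integrable_of_hasCompactSupport
        (HasCompactSupport.of_compactSpace _)) (Eventually.of_forall fun t => (hp n t).le)]
    have h := integral_poissonKernel_mul hf (hr0 n) (hr1 n) (z := 0) (by simp)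
    simp only [mul_zero, hf0] at h
    rw [ENNReal.ofReal_eq_one, ← h]
    refine integral_congr_ae (Eventually.of_forall fun s => ?_)
    simp [poissonKernel]
  let P : ℕ → ProbabilityMeasure Circle := fun n => ⟨p n, hprob n⟩
  -- The densities Re f(r_n t) define probability measures. Weak compactness gives a limit along an
  -- ultrafilter, and the Poisson kernel is a continuous test function.
  obtain ⟨μ, -, hμ⟩ := isCompact_univ.ultrafilter_le_nhds
    (Ultrafilter.map P (hyperfilter ℕ)) (by simp)
  have hμ : Tendsto P (hyperfilter ℕ) (𝓝 μ) := hμ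
  refine ⟨μ, inferInstance, fun z hz => ?_⟩
  have h1 := ProbabilityMeasure.tendsto_iff_forall_integral_tendsto.1 hμ
    (BoundedContinuousFunction.mkOfCompact ⟨_, continuous_poissonKernel hz⟩)
  have h2 : Tendsto (fun n => (f (r n * z)).re) (hyperfilter ℕ) (𝓝 (f z).re) := by
    refine Tendsto.mono_left ?_ Nat.hyperfilter_le_atTop
    have h3 := (tendsto_mul_nhdsLT z).comp hrlim'
    exact (Complex.continuous_re.tendsto _).comp
      (((hf.differentiableAt (isOpen_disk.mem_nhds hz)).continuousAt.tendsto).comp h3)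
  refine tendsto_nhds_unique h1 (h2.congr fun n => ?_)
  exact (hint n z hz).symm

/-- Adding C + 1 makes the real part positive, and scaling by c⁻¹ normalizes it at 0. It is then a
Poisson integral by Herglotz, and Fatou's theorem applies. -/
lemma ae_exists_tendsto_re_of_bounded {f : ℂ → ℂ} (hf : BoundedHolomorphicOn f disk) :
    ∀ᵐ t : Circle ∂m, ∃ l : ℝ, Tendsto (fun r : ℝ => (f (r * t)).re) (𝓝[<] 1) (𝓝 l) := by
  obtain ⟨hd, C, hC⟩ := hf
  have hpos : ∀ z ∈ disk, 0 < (f z).re + (C + 1) := fun z hz => by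
    have := (abs_le.1 ((Complex.abs_re_le_norm (f z)).trans (hC z hz))).1
    linarith
  set c : ℝ := (f 0).re + (C + 1) with hc
  have hc0 : 0 < c := hpos 0 zero_mem_disk
  obtain ⟨μ, hμ, h⟩ := exists_probabilityMeasure_of_re_pos
    (f := fun z => (c⁻¹ : ℝ) * (f z + (C + 1 : ℝ)))
    ((hd.add_const _).const_mul _) (fun z hz => by
      rw [Complex.re_ofReal_mul, Complex.add_re, Complex.ofReal_re]
      exact mul_pos (inv_pos.2 hc0) (hpos z hz)) (by
      rw [Complex.re_ofReal_mul, Complex.add_re, Complex.ofReal_re, ← hc,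
        inv_mul_cancel₀ hc0.ne'])
  filter_upwards [ae_tendsto_integral_poissonKernel μ] with t ht
  refine ⟨_, ((ht.const_mul c).sub_const (C + 1)).congr' ?_⟩
  filter_upwards [eventually_mem_Ioo] with r hr
  rw [h _ (mul_circle_mem_disk hr.1 hr.2 t), Complex.re_ofReal_mul, Complex.add_re,
    Complex.ofReal_re, mul_inv_cancel_left₀ hc0.ne', add_sub_cancel_right]

lemma BoundedHolomorphicOn.const_mul {f : ℂ → ℂ} {G : Set ℂ} (hf : BoundedHolomorphicOn f G)
    (c : ℂ) : BoundedHolomorphicOn (fun z => c * f z) G := by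
  obtain ⟨hd, C, hC⟩ := hf
  refine ⟨hd.const_mul c, ‖c‖ * C, fun z hz => ?_⟩
  rw [norm_mul]
  exact mul_le_mul_of_nonneg_left (hC z hz) (norm_nonneg c)

lemma ae_exists_tendsto_of_bounded {f : ℂ → ℂ} (hf : BoundedHolomorphicOn f disk) :
    ∀ᵐ t : Circle ∂m, ∃ l : ℂ, Tendsto (fun r : ℝ => f (r * t)) (𝓝[<] 1) (𝓝 l) := by
  filter_upwards [ae_exists_tendsto_re_of_bounded hf,
    ae_exists_tendsto_re_of_bounded (hf.const_mul (-Complex.I))] with t ⟨a, ha⟩ ⟨b, hb⟩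
  refine ⟨a + b * Complex.I, ?_⟩
  have ha' := (Complex.continuous_ofReal.tendsto a).comp ha
  have hb' := (Complex.continuous_ofReal.tendsto b).comp hb
  refine (ha'.add (hb'.mul_const Complex.I)).congr fun r => ?_
  simp [Complex.re_add_im]

/-- A bounded holomorphic function in the disk has radial limits almost everywhere. -/
theorem BoundedHolomorphicOn.exists_isInnerBoundary {f : ℂ → ℂ}
    (hf : BoundedHolomorphicOn f disk) : ∃ b, IsInnerBoundary f b := by
  obtain ⟨u, hu, hlim⟩ := exists_seq_tendsto_nhdsLT
  have h := ae_exists_tendsto_of_bounded hf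
  -- Passing to a sequence of radii supplies a measurable version of the radial limit.
  obtain ⟨b, hb, hb'⟩ := measurable_limit_of_tendsto_metrizable_ae (μ := m) (L := atTop)
    (f := fun n (t : Circle) => f (u n * t))
    (fun n => (hf.1.continuous_circle (by linarith [(hu n).1]) (hu n).2).measurable.aemeasurable)
    (by filter_upwards [h] with t ⟨l, hl⟩ using ⟨l, hl.comp hlim⟩)
  refine ⟨b, hb, ?_⟩
  filter_upwards [h, hb'] with t ⟨l, hl⟩ ht
  rwa [tendsto_nhds_unique ht (hl.comp hlim)]

/-! ### Zeros, Jensen's formula and log-integrability of boundary values -/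

lemma analyticOnNhd_disk {g : ℂ → ℂ} (hg : DifferentiableOn ℂ g disk) : AnalyticOnNhd ℂ g disk :=
  hg.analyticOnNhd isOpen_disk

lemma isPreconnected_disk : IsPreconnected disk := by
  rw [disk_eq_ball]; exact (convex_ball _ _).isPreconnected

lemma countable_zeros {g : ℂ → ℂ} (hg : DifferentiableOn ℂ g disk) (hne : ∃ z ∈ disk, g z ≠ 0) :
    ({z | g z = 0} ∩ disk).Countable := by
  refine (HereditarilyLindelofSpace.isLindelof _).countable_of_isDiscrete
    (isDiscrete_of_codiscreteWithin (U := disk) ?_)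
  rcases (analyticOnNhd_disk hg).eqOn_zero_or_eventually_ne_zero_of_preconnected
    isPreconnected_disk with h | h
  · obtain ⟨z, hz, hgz⟩ := hne
    exact absurd (h hz) hgz
  · filter_upwards [h] with z hz h'
    exact hz h'

/-- Distinct radii meet only at 0, so choosing a zero on each bad radius injects the bad directions
into the countable zero set; `m` has no atoms. -/
lemma ae_forall_radius_ne_zero {g : ℂ → ℂ} (hg : DifferentiableOn ℂ g disk)
    (hne : ∃ z ∈ disk, g z ≠ 0) :
    ∀ᵐ t : Circle ∂m, ∀ r : ℝ, 0 < r → r < 1 → g (r * t) ≠ 0 := by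
  have hB : {t : Circle | ¬ ∀ r : ℝ, 0 < r → r < 1 → g (r * t) ≠ 0}.Countable := by
    have hex : ∀ t : Circle, ∃ r : ℝ, (¬ ∀ r : ℝ, 0 < r → r < 1 → g (r * t) ≠ 0) →
        0 < r ∧ r < 1 ∧ g (r * t) = 0 := by
      intro t
      by_cases h : ∀ r : ℝ, 0 < r → r < 1 → g (r * t) ≠ 0
      · exact ⟨0, fun h' => absurd h h'⟩
      · push Not at h
        obtain ⟨r, hr⟩ := h
        exact ⟨r, fun _ => hr⟩
    choose ρ hρ using hex
    refine MapsTo.countable_of_injOn (f := fun t : Circle => (ρ t : ℂ) * t)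
      (t := ({z | g z = 0} ∩ disk)) (fun t ht => ?_) (fun t ht s hs hts => ?_)
      (countable_zeros hg hne)
    · obtain ⟨h0, h1, h2⟩ := hρ t ht
      exact ⟨h2, mul_circle_mem_disk h0 h1 t⟩
    · obtain ⟨h0, -, -⟩ := hρ t ht
      obtain ⟨h0', -, -⟩ := hρ s hs
      have hts : (ρ t : ℂ) * t = ρ s * s := hts
      have hn := congrArg norm hts
      rw [norm_mul, norm_mul, Circle.norm_coe, Circle.norm_coe, Complex.norm_real,
        Complex.norm_real, Real.norm_eq_abs, Real.norm_eq_abs, abs_of_pos h0, abs_of_pos h0',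
        mul_one, mul_one] at hn
      rw [hn] at hts
      exact Circle.ext (mul_left_cancel₀ (Complex.ofReal_ne_zero.2 h0'.ne') hts)
  rw [ae_iff]
  exact hB.measure_zero m

lemma closedBall_subset_disk {r : ℝ} (h0 : 0 < r) (h1 : r < 1) : closedBall 0 |r| ⊆ disk := by
  rw [abs_of_pos h0, disk_eq_ball]
  exact closedBall_subset_ball h1

/-- Jensen's formula: the zeros away from the origin contribute nonnegative terms, and the term
(order at 0) · log r is bounded below for r ≥ 1/2. -/
lemma exists_le_circleAverage_log {g : ℂ → ℂ} (hg : DifferentiableOn ℂ g disk) :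
    ∃ K : ℝ, ∀ r : ℝ, 1 / 2 ≤ r → r < 1 → K ≤ Real.circleAverage (Real.log ‖g ·‖) 0 r := by
  refine ⟨((meromorphicOrderAt g 0).untop₀ : ℝ) * Real.log (1 / 2)
    + Real.log ‖meromorphicTrailingCoeffAt g 0‖, fun r hr h1 => ?_⟩
  have h0 : 0 < r := by linarith
  have ha : AnalyticOnNhd ℂ g (closedBall 0 |r|) :=
    (analyticOnNhd_disk hg).mono (closedBall_subset_disk h0 h1)
  have hdiv : ∀ u, 0 ≤ MeromorphicOn.divisor g (closedBall 0 |r|) u :=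
    fun u => MeromorphicOn.AnalyticOnNhd.divisor_nonneg ha u
  have h00 := hdiv 0
  rw [ha.meromorphicOn.circleAverage_log_norm h0.ne']
  rw [ha.meromorphicOn.divisor_apply (by simp)] at h00 ⊢
  have h2 : (0 : ℝ) ≤ ∑ᶠ u, (MeromorphicOn.divisor g (closedBall 0 |r|) u : ℝ) *
      Real.log (r * ‖(0 : ℂ) - u‖⁻¹) := by
    refine finsum_nonneg fun u => ?_
    by_cases hu : u ∈ closedBall (0 : ℂ) |r|
    · refine mul_nonneg (by exact_mod_cast hdiv u) ?_
      rcases eq_or_ne u 0 with rfl | hu0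
      · simp
      · rw [mem_closedBall, dist_zero_right, abs_of_pos h0] at hu
        have : 0 < ‖u‖ := norm_pos_iff.2 hu0
        rw [zero_sub, norm_neg]
        refine Real.log_nonneg ?_
        rw [← div_eq_mul_inv, one_le_div this]
        exact hu
    · rw [Function.locallyFinsuppWithin.apply_eq_zero_of_notMem _ hu]
      simp
  have h3 : Real.log (1 / 2) ≤ Real.log r := Real.log_le_log (by norm_num) hr
  have h4 : (0 : ℝ) ≤ ((meromorphicOrderAt g 0).untop₀ : ℝ) := by exact_mod_cast h00
  nlinarith [mul_le_mul_of_nonneg_left h3 h4]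

lemma exists_lintegral_log_le {g : ℂ → ℂ} (hg : BoundedHolomorphicOn g disk) :
    ∃ K : ENNReal, K ≠ ⊤ ∧ ∀ r : ℝ, 1 / 2 ≤ r → r < 1 →
      ∫⁻ t : Circle, ‖Real.log ‖g (r * t)‖‖ₑ ∂m ≤ K := by
  obtain ⟨hd, C, hC⟩ := hg
  obtain ⟨K, hK⟩ := exists_le_circleAverage_log hd
  -- If x ≤ L and L ≥ 0, then |x| ≤ 2L - x, so Jensen's lower bound for the mean of log |g| controls
  -- the mean of its absolute value.
  set L := Real.log (max C 1) with hL
  have hL0 : 0 ≤ L := Real.log_nonneg (le_max_right _ _)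
  refine ⟨ENNReal.ofReal (2 * L - K), ENNReal.ofReal_ne_top, fun r hr h1 => ?_⟩
  have h0 : 0 < r := by linarith
  have hm : AEStronglyMeasurable (fun t : Circle => Real.log ‖g (r * t)‖) m :=
    (Real.measurable_log.comp (hd.continuous_circle h0 h1).norm.measurable).aestronglyMeasurable
  have ha : MeromorphicOn g (sphere 0 |r|) :=
    ((analyticOnNhd_disk hd).mono ((sphere_subset_closedBall).trans
      (closedBall_subset_disk h0 h1))).meromorphicOn
  have hi : Integrable (fun t : Circle => Real.log ‖g (r * t)‖) m :=
    circleIntegrable_iff (f := fun z => Real.log ‖g z‖) hm ha.circleIntegrable_log_norm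
  rw [← ofReal_integral_norm_eq_lintegral_enorm hi]
  refine ENNReal.ofReal_le_ofReal ?_
  calc ∫ t : Circle, ‖Real.log ‖g (r * t)‖‖ ∂m
      ≤ ∫ t : Circle, (2 * L - Real.log ‖g (r * t)‖) ∂m := by
        refine integral_mono hi.norm ((integrable_const _).sub hi) fun t => ?_
        have h2 : Real.log ‖g (r * t)‖ ≤ L := by
          rcases eq_or_ne (g (r * t)) 0 with h | h
          · simpa [h] using hL0
          · exact Real.log_le_log (norm_pos_iff.2 h)
              ((hC _ (mul_circle_mem_disk h0 h1 t)).trans (le_max_left _ _))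
        simp only [Real.norm_eq_abs]
        exact abs_le.2 ⟨by linarith, by linarith⟩
    _ = 2 * L - Real.circleAverage (Real.log ‖g ·‖) 0 r := by
        rw [integral_sub (integrable_const _) hi, ← integral_m (f := fun z => Real.log ‖g z‖) hm]
        simp
    _ ≤ 2 * L - K := by linarith [hK r hr h1]

/-- The extended-real valued function `|log x|`, equal to `∞` at `0`. -/
def elogAbs (x : ℝ) : ENNReal := if x = 0 then ⊤ else ‖Real.log x‖ₑ

lemma measurable_elogAbs : Measurable elogAbs :=
  Measurable.ite (measurableSet_singleton 0) measurable_const Real.measurable_log.enorm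

/-- The value ∞ at 0 gives continuity there, unlike `Real.log 0 = 0`. A finite integral of the limit
therefore also excludes zeros of the boundary function. -/
lemma tendsto_elogAbs {x : ℕ → ℝ} {l : ℝ} (hx : ∀ n, x n ≠ 0) (h : Tendsto x atTop (𝓝 l)) :
    Tendsto (fun n => elogAbs (x n)) atTop (𝓝 (elogAbs l)) := by
  have h1 : (fun n => elogAbs (x n)) = fun n => ‖Real.log (x n)‖ₑ := by
    funext n; simp [elogAbs, hx n]
  rw [h1]
  rcases eq_or_ne l 0 with rfl | hl
  · have h2 : Tendsto x atTop (𝓝[≠] 0) := tendsto_nhdsWithin_iff.2 ⟨h, Eventually.of_forall hx⟩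
    have h3 := tendsto_abs_atBot_atTop.comp (Real.tendsto_log_nhdsNE_zero.comp h2)
    simpa [elogAbs, Function.comp_def, Real.enorm_eq_ofReal_abs] using
      ENNReal.tendsto_ofReal_atTop.comp h3
  · rw [elogAbs, if_neg hl]
    exact ((Real.continuousAt_log hl).tendsto.comp h).enorm

/-- The boundary function of a bounded holomorphic function that does not vanish identically is
nonzero almost everywhere and log-integrable. -/
theorem BoundedHolomorphicOn.integrable_log_boundary {g : ℂ → ℂ} {b : Circle → ℂ}
    (hg : BoundedHolomorphicOn g disk) (hne : ∃ z ∈ disk, g z ≠ 0) (hb : IsInnerBoundary g b) :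
    (∀ᵐ t ∂m, b t ≠ 0) ∧ Integrable (fun t => Real.log ‖b t‖) m := by
  obtain ⟨u, hu, hlim⟩ := exists_seq_tendsto_nhdsLT
  have hu0 : ∀ n, 0 < u n := fun n => by linarith [(hu n).1]
  obtain ⟨K, hK, hle⟩ := exists_lintegral_log_le hg
  have hmeas : ∀ n, Measurable fun t : Circle => elogAbs ‖g (u n * t)‖ := fun n =>
    measurable_elogAbs.comp (hg.1.continuous_circle (hu0 n) (hu n).2).norm.measurable
  have hmeasb : Measurable fun t => elogAbs ‖b t‖ := measurable_elogAbs.comp hb.1.norm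
  have hfin : ∫⁻ t, elogAbs ‖b t‖ ∂m ≤ K := by
    -- Fatou's lemma along the radii u n, with the uniform bound K from Jensen's formula.
    calc ∫⁻ t, elogAbs ‖b t‖ ∂m
        = ∫⁻ t : Circle, liminf (fun n => elogAbs ‖g (u n * t)‖) atTop ∂m := by
          refine lintegral_congr_ae ?_
          filter_upwards [hb.2, ae_forall_radius_ne_zero hg.1 hne] with t ht h0
          exact (tendsto_elogAbs (fun n => norm_ne_zero_iff.2 (h0 _ (hu0 n) (hu n).2))
            (ht.comp hlim).norm).liminf_eq.symm
      _ ≤ liminf (fun n => ∫⁻ t : Circle, elogAbs ‖g (u n * t)‖ ∂m) atTop :=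
          lintegral_liminf_le hmeas
      _ ≤ K := by
          refine liminf_le_of_le (by isBoundedDefault) fun a ha => ?_
          obtain ⟨n, hn⟩ := ha.exists
          refine hn.trans (le_trans (lintegral_mono_ae ?_) (hle (u n) (hu n).1 (hu n).2))
          filter_upwards [ae_forall_radius_ne_zero hg.1 hne] with t h0
          rw [elogAbs, if_neg (norm_ne_zero_iff.2 (h0 _ (hu0 n) (hu n).2))]
  have hne' : ∀ᵐ t ∂m, b t ≠ 0 := by
    filter_upwards [ae_lt_top hmeasb (hfin.trans_lt hK.lt_top).ne] with t ht h0
    simp [elogAbs, h0] at ht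
  refine ⟨hne', ((Real.measurable_log.comp hb.1.norm).aestronglyMeasurable), ?_⟩
  refine lt_of_le_of_lt (le_trans (le_of_eq (lintegral_congr_ae ?_)) hfin) hK.lt_top
  filter_upwards [hne'] with t ht
  rw [elogAbs, if_neg (norm_ne_zero_iff.2 ht)]

/-! ### The field of boundary quotients -/

lemma BoundedHolomorphicOn.mul {f g : ℂ → ℂ} {G : Set ℂ} (hf : BoundedHolomorphicOn f G)
    (hg : BoundedHolomorphicOn g G) : BoundedHolomorphicOn (fun z => f z * g z) G := by
  obtain ⟨hf, C, hC⟩ := hf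
  obtain ⟨hg, D, hD⟩ := hg
  refine ⟨hf.mul hg, C * D, fun z hz => ?_⟩
  rw [norm_mul]
  exact mul_le_mul (hC z hz) (hD z hz) (norm_nonneg _) ((norm_nonneg _).trans (hC z hz))

lemma BoundedHolomorphicOn.add {f g : ℂ → ℂ} {G : Set ℂ} (hf : BoundedHolomorphicOn f G)
    (hg : BoundedHolomorphicOn g G) : BoundedHolomorphicOn (fun z => f z + g z) G := by
  obtain ⟨hf, C, hC⟩ := hf
  obtain ⟨hg, D, hD⟩ := hg
  exact ⟨hf.add hg, C + D, fun z hz => (norm_add_le _ _).trans (add_le_add (hC z hz) (hD z hz))⟩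

lemma boundedHolomorphicOn_const (c : ℂ) (G : Set ℂ) : BoundedHolomorphicOn (fun _ => c) G :=
  ⟨differentiableOn_const _, ‖c‖, fun _ _ => le_rfl⟩

lemma boundedHolomorphicOn_id : BoundedHolomorphicOn (fun z => z) disk :=
  ⟨differentiableOn_id, 1, fun _ hz => le_of_lt hz⟩

lemma IsInnerBoundary.mul {f g : ℂ → ℂ} {a b : Circle → ℂ} (hf : IsInnerBoundary f a)
    (hg : IsInnerBoundary g b) : IsInnerBoundary (fun z => f z * g z) (fun t => a t * b t) := by
  refine ⟨hf.1.mul hg.1, ?_⟩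
  filter_upwards [hf.2, hg.2] with t h1 h2 using h1.mul h2

lemma IsInnerBoundary.add {f g : ℂ → ℂ} {a b : Circle → ℂ} (hf : IsInnerBoundary f a)
    (hg : IsInnerBoundary g b) : IsInnerBoundary (fun z => f z + g z) (fun t => a t + b t) := by
  refine ⟨hf.1.add hg.1, ?_⟩
  filter_upwards [hf.2, hg.2] with t h1 h2 using h1.add h2

lemma isInnerBoundary_const (c : ℂ) : IsInnerBoundary (fun _ => c) (fun _ => c) :=
  ⟨measurable_const, Eventually.of_forall fun _ => tendsto_const_nhds⟩

lemma measurable_circle_coe : Measurable fun t : Circle => (t : ℂ) :=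
  (by fun_prop : Continuous fun t : Circle => (t : ℂ)).measurable

lemma isInnerBoundary_id : IsInnerBoundary (fun z => z) (fun t => t) :=
  ⟨measurable_circle_coe, Eventually.of_forall fun t => tendsto_mul_nhdsLT t⟩

lemma IsInnerBoundary.ae_unique {f : ℂ → ℂ} {a b : Circle → ℂ} (hf : IsInnerBoundary f a)
    (hg : IsInnerBoundary f b) : a =ᵐ[m] b := by
  filter_upwards [hf.2, hg.2] with t h1 h2 using tendsto_nhds_unique h1 h2

lemma exists_mul_ne_zero {f g : ℂ → ℂ} (hf : DifferentiableOn ℂ f disk)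
    (hg : DifferentiableOn ℂ g disk) (hf0 : ∃ z ∈ disk, f z ≠ 0) (hg0 : ∃ z ∈ disk, g z ≠ 0) :
    ∃ z ∈ disk, f z * g z ≠ 0 := by
  obtain ⟨t, h1, h2⟩ :=
    ((ae_forall_radius_ne_zero hf hf0).and (ae_forall_radius_ne_zero hg hg0)).exists
  have h0 : (0 : ℝ) < 1 / 2 := by norm_num
  have h3 : (1 / 2 : ℝ) < 1 := by norm_num
  exact ⟨_, mul_circle_mem_disk h0 h3 t, mul_ne_zero (h1 _ h0 h3) (h2 _ h0 h3)⟩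

/-- Functions on the circle that are (almost everywhere) the quotient of the boundary functions of
two bounded holomorphic functions in the disk. -/
def IsBoundaryQuotient (b : Circle → ℂ) : Prop :=
  ∃ (f g : ℂ → ℂ) (a c : Circle → ℂ), BoundedHolomorphicOn f disk ∧ BoundedHolomorphicOn g disk ∧
    (∃ z ∈ disk, g z ≠ 0) ∧ IsInnerBoundary f a ∧ IsInnerBoundary g c ∧
    b =ᵐ[m] fun t => a t / c t

namespace IsBoundaryQuotient

lemma congr {a b : Circle → ℂ} (ha : IsBoundaryQuotient a) (h : b =ᵐ[m] a) :
    IsBoundaryQuotient b := by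
  obtain ⟨f, g, p, q, hf, hg, hg0, hp, hq, e⟩ := ha
  exact ⟨f, g, p, q, hf, hg, hg0, hp, hq, h.trans e⟩

lemma of_bounded {f : ℂ → ℂ} {b : Circle → ℂ} (hf : BoundedHolomorphicOn f disk)
    (hb : IsInnerBoundary f b) : IsBoundaryQuotient b :=
  ⟨f, fun _ => 1, b, fun _ => 1, hf, boundedHolomorphicOn_const 1 _,
    ⟨0, zero_mem_disk, one_ne_zero⟩, hb, isInnerBoundary_const 1, by simp⟩

lemma const (c : ℂ) : IsBoundaryQuotient fun _ => c :=
  of_bounded (boundedHolomorphicOn_const c _) (isInnerBoundary_const c)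

lemma coe : IsBoundaryQuotient fun t => (t : ℂ) :=
  of_bounded boundedHolomorphicOn_id isInnerBoundary_id

lemma mul {a b : Circle → ℂ} (ha : IsBoundaryQuotient a) (hb : IsBoundaryQuotient b) :
    IsBoundaryQuotient fun t => a t * b t := by
  obtain ⟨f, g, p, q, hf, hg, hg0, hp, hq, e⟩ := ha
  obtain ⟨f', g', p', q', hf', hg', hg0', hp', hq', e'⟩ := hb
  refine ⟨_, _, _, _, hf.mul hf', hg.mul hg', exists_mul_ne_zero hg.1 hg'.1 hg0 hg0',
    hp.mul hp', hq.mul hq', ?_⟩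
  filter_upwards [e, e'] with t h h'
  rw [h, h', div_mul_div_comm]

lemma add {a b : Circle → ℂ} (ha : IsBoundaryQuotient a) (hb : IsBoundaryQuotient b) :
    IsBoundaryQuotient fun t => a t + b t := by
  obtain ⟨f, g, p, q, hf, hg, hg0, hp, hq, e⟩ := ha
  obtain ⟨f', g', p', q', hf', hg', hg0', hp', hq', e'⟩ := hb
  refine ⟨_, _, _, _, (hf.mul hg').add (hg.mul hf'), hg.mul hg',
    exists_mul_ne_zero hg.1 hg'.1 hg0 hg0', (hp.mul hq').add (hq.mul hp'), hq.mul hq', ?_⟩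
  filter_upwards [e, e', (hg.integrable_log_boundary hg0 hq).1,
    (hg'.integrable_log_boundary hg0' hq').1] with t h h' h1 h2
  rw [h, h', div_add_div _ _ h1 h2]

lemma sub {a b : Circle → ℂ} (ha : IsBoundaryQuotient a) (hb : IsBoundaryQuotient b) :
    IsBoundaryQuotient fun t => a t - b t :=
  (ha.add ((const (-1)).mul hb)).congr (Eventually.of_forall fun t => by ring)

lemma inv {a : Circle → ℂ} (ha : IsBoundaryQuotient a) : IsBoundaryQuotient fun t => (a t)⁻¹ := by
  obtain ⟨f, g, p, q, hf, hg, hg0, hp, hq, e⟩ := ha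
  by_cases hf0 : ∃ z ∈ disk, f z ≠ 0
  · refine ⟨g, f, q, p, hg, hf, hf0, hq, hp, ?_⟩
    filter_upwards [e] with t h
    rw [h, inv_div]
  · push Not at hf0
    refine (const 0).congr ?_
    filter_upwards [e, hp.2] with t h h'
    have : p t = 0 := by
      refine tendsto_nhds_unique h' (tendsto_const_nhds.congr' ?_)
      filter_upwards [eventually_mem_Ioo] with r hr
      exact (hf0 _ (mul_circle_mem_disk hr.1 hr.2 t)).symm
    rw [h, this, zero_div, inv_zero]

lemma div {a b : Circle → ℂ} (ha : IsBoundaryQuotient a) (hb : IsBoundaryQuotient b) :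
    IsBoundaryQuotient fun t => a t / b t :=
  (ha.mul hb.inv).congr (Eventually.of_forall fun _ => div_eq_mul_inv _ _)

/-- The numerator does not vanish identically, since otherwise b = 0 a.e. Hence numerator and
denominator both have log-integrable boundary values, and log |b| is their difference. -/
lemma integrable_log {b : Circle → ℂ} (hb : IsBoundaryQuotient b) (h : ¬ ∀ᵐ t ∂m, b t = 0) :
    (∀ᵐ t ∂m, b t ≠ 0) ∧ Integrable (fun t => Real.log ‖b t‖) m := by
  obtain ⟨f, g, p, q, hf, hg, hg0, hp, hq, e⟩ := hb
  have hf0 : ∃ z ∈ disk, f z ≠ 0 := by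
    by_contra hf0
    push Not at hf0
    apply h
    filter_upwards [e, hp.2] with t h h'
    have : p t = 0 := by
      refine tendsto_nhds_unique h' (tendsto_const_nhds.congr' ?_)
      filter_upwards [eventually_mem_Ioo] with r hr
      exact (hf0 _ (mul_circle_mem_disk hr.1 hr.2 t)).symm
    rw [h, this, zero_div]
  obtain ⟨h1, h2⟩ := hf.integrable_log_boundary hf0 hp
  obtain ⟨h3, h4⟩ := hg.integrable_log_boundary hg0 hq
  refine ⟨?_, (h2.sub h4).congr ?_⟩
  · filter_upwards [e, h1, h3] with t h h' h''
    rw [h]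
    exact div_ne_zero h' h''
  · filter_upwards [e, h1, h3] with t h h' h''
    rw [h, norm_div, Real.log_div (norm_ne_zero_iff.2 h') (norm_ne_zero_iff.2 h''), Pi.sub_apply]

end IsBoundaryQuotient

lemma NMDisk.exists_isInnerBoundary {h : ℂ → ℂ} (hh : NMDisk h) :
    ∃ b, IsInnerBoundary h b ∧ IsBoundaryQuotient b := by
  obtain ⟨-, f, g, hf, hg, hg0, e⟩ := hh
  obtain ⟨p, hp⟩ := hf.exists_isInnerBoundary
  obtain ⟨q, hq⟩ := hg.exists_isInnerBoundary
  refine ⟨fun t => p t / q t, ⟨hp.1.div hq.1, ?_⟩, f, g, p, q, hf, hg, hg0, hp, hq, ae_eq_rfl⟩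
  filter_upwards [hp.2, hq.2, (hg.integrable_log_boundary hg0 hq).1,
    ae_forall_radius_ne_zero hg.1 hg0] with t h1 h2 h3 h4
  refine (h1.div h2 h3).congr' ?_
  filter_upwards [eventually_mem_Ioo] with r hr
  exact (e _ (mul_circle_mem_disk hr.1 hr.2 t) (h4 r hr.1 hr.2)).symm

/-! ### Reflection in the circle and the criterion for pseudocontinuation -/

lemma isOpen_exterior : IsOpen exterior := isOpen_lt continuous_const continuous_norm

lemma conj_inv_mem_disk {z : ℂ} (hz : z ∈ exterior) : conj z⁻¹ ∈ disk := by
  rw [disk, mem_ofPred_eq, RCLike.norm_conj, norm_inv]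
  exact inv_lt_one_of_one_lt₀ hz

lemma inv_mem_exterior {z : ℂ} (hz : z ∈ disk) (h0 : z ≠ 0) : z⁻¹ ∈ exterior := by
  rw [exterior, mem_ofPred_eq, norm_inv]
  exact (one_lt_inv₀ (norm_pos_iff.2 h0)).2 hz

/-- Reflection in the unit circle turns bounded holomorphic functions in the exterior into bounded
holomorphic functions in the disk. -/
lemma exists_reflection {f : ℂ → ℂ} (hf : BoundedHolomorphicOn f exterior)
    (hf' : HolomorphicAtInfty f) :
    ∃ F, BoundedHolomorphicOn F disk ∧ ∀ z ≠ 0, F z = conj (f (conj z)⁻¹) := by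
  obtain ⟨l, hl⟩ := hf'
  obtain ⟨hd, C, hC⟩ := hf
  set u := Function.update (fun w : ℂ => f w⁻¹) 0 l with hu
  have hu' : ∀ w ≠ 0, u w = f w⁻¹ := fun w hw => by simp [hu, hw]
  have hud : ∀ w ∈ disk, DifferentiableAt ℂ u w := by
    intro w hw
    rcases eq_or_ne w 0 with rfl | h0
    · exact hl.differentiableAt
    · have h1 : DifferentiableAt ℂ (fun w => f w⁻¹) w :=
        (hd.differentiableAt (isOpen_exterior.mem_nhds (inv_mem_exterior hw h0))).comp w
          (differentiableAt_inv h0)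
      refine h1.congr_of_eventuallyEq ?_
      filter_upwards [isOpen_ne.mem_nhds h0] with z hz using hu' z hz
  have hconj : ∀ w ∈ disk, conj w ∈ disk := fun w hw => by
    rw [disk, mem_ofPred_eq, RCLike.norm_conj]; exact hw
  refine ⟨conj ∘ u ∘ conj, ⟨fun w hw => ?_, max C ‖l‖, fun w hw => ?_⟩, fun w hw => ?_⟩
  · refine (DifferentiableAt.differentiableWithinAt ?_)
    rw [differentiableAt_conj_conj_iff]
    exact hud _ (hconj w hw)
  · simp only [Function.comp_apply, RCLike.norm_conj]
    rcases eq_or_ne w 0 with rfl | h0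
    · simp [hu]
    · have h0 : conj w ≠ 0 := by simpa using h0
      rw [hu' _ h0]
      exact (hC _ (inv_mem_exterior (hconj w hw) h0)).trans (le_max_left _ _)
  · have h0 : conj w ≠ 0 := by simpa using hw
    simp only [Function.comp_apply, hu' _ h0]

lemma conj_mul_circle_inv (r : ℝ) (t : Circle) : (conj ((r : ℂ) * t))⁻¹ = (r⁻¹ : ℝ) * t := by
  rw [map_mul, Complex.conj_ofReal, mul_inv, ← Circle.coe_inv_eq_conj, ← Circle.coe_inv, inv_inv,
    Complex.ofReal_inv]

lemma tendsto_inv_nhdsLT_one : Tendsto (fun r : ℝ => r⁻¹) (𝓝[<] 1) (𝓝[>] 1) := by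
  refine tendsto_nhdsWithin_iff.2 ⟨?_, ?_⟩
  · simpa using ((continuousAt_inv₀ (one_ne_zero (α := ℝ))).tendsto).mono_left
      (nhdsWithin_le_nhds (s := Iio 1))
  · filter_upwards [eventually_mem_Ioo] with r hr using (one_lt_inv₀ hr.1).2 hr.2

lemma tendsto_inv_nhdsGT_one : Tendsto (fun r : ℝ => r⁻¹) (𝓝[>] 1) (𝓝[<] 1) := by
  refine tendsto_nhdsWithin_iff.2 ⟨?_, ?_⟩
  · simpa using ((continuousAt_inv₀ (one_ne_zero (α := ℝ))).tendsto).mono_left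
      (nhdsWithin_le_nhds (s := Ioi 1))
  · filter_upwards [self_mem_nhdsWithin] with r (hr : 1 < r) using inv_lt_one_of_one_lt₀ hr

/-- Reflecting numerator and denominator gives conj k(1 / conj z) as a quotient in the disk; its
radial limit is conj (c t) because z ↦ 1 / conj z sends rt to r⁻¹t. -/
lemma NMExterior.isBoundaryQuotient_conj {k : ℂ → ℂ} {c : Circle → ℂ} (hk : NMExterior k)
    (hc : IsOuterBoundary k c) : IsBoundaryQuotient fun t => conj (c t) := by
  obtain ⟨-, -, f, g, hf, hf', hg, hg', ⟨z, hz, hgz⟩, e⟩ := hk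
  obtain ⟨F, hF, eF⟩ := exists_reflection hf hf'
  obtain ⟨G, hG, eG⟩ := exists_reflection hg hg'
  have hG0 : ∃ z ∈ disk, G z ≠ 0 := by
    have hz0 : z ≠ 0 := by
      rintro rfl
      have hz : 1 < ‖(0 : ℂ)‖ := hz
      norm_num at hz
    refine ⟨conj z⁻¹, conj_inv_mem_disk hz, ?_⟩
    rw [eG _ (by simpa using hz0)]
    simpa using hgz
  obtain ⟨p, hp⟩ := hF.exists_isInnerBoundary
  obtain ⟨q, hq⟩ := hG.exists_isInnerBoundary
  refine ⟨F, G, p, q, hF, hG, hG0, hp, hq, ?_⟩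
  filter_upwards [hp.2, hq.2, (hG.integrable_log_boundary hG0 hq).1,
    ae_forall_radius_ne_zero hG.1 hG0, hc.2] with t h1 h2 h3 h4 h5
  have h6 := (Complex.continuous_conj.tendsto (c t)).comp (h5.comp tendsto_inv_nhdsLT_one)
  refine tendsto_nhds_unique h6 ((h1.div h2 h3).congr' ?_)
  filter_upwards [eventually_mem_Ioo] with r hr
  have hr0 : (r : ℂ) * t ≠ 0 :=
    mul_ne_zero (Complex.ofReal_ne_zero.2 hr.1.ne') (Circle.coe_ne_zero t)
  have h7 := h4 r hr.1 hr.2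
  have h8 := inv_mem_exterior (z := conj ((r : ℂ) * t))
    (by rw [disk, mem_ofPred_eq, RCLike.norm_conj]; exact mul_circle_mem_disk hr.1 hr.2 t)
    (by simpa using hr0)
  rw [eG _ hr0] at h7
  rw [Pi.div_apply, eF _ hr0, eG _ hr0, conj_mul_circle_inv]
  rw [conj_mul_circle_inv] at h7 h8
  rw [Function.comp_apply, Function.comp_apply, e _ h8 (by simpa using h7), map_div₀]

lemma boundedHolomorphicOn_reflection {F : ℂ → ℂ} (hF : BoundedHolomorphicOn F disk) :
    BoundedHolomorphicOn (fun z => conj (F (conj z⁻¹))) exterior ∧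
      AnalyticAt ℂ (fun z => conj (F (conj z))) 0 := by
  obtain ⟨hd, C, hC⟩ := hF
  have h1 : ∀ z, conj z ∈ disk → DifferentiableAt ℂ (conj ∘ F ∘ conj) z := by
    intro z hz
    rw [differentiableAt_conj_conj_iff]
    exact hd.differentiableAt (isOpen_disk.mem_nhds hz)
  refine ⟨⟨fun z hz => ?_, C, fun z hz => ?_⟩, ?_⟩
  · have hz0 : z ≠ 0 := by
      rintro rfl
      have hz : 1 < ‖(0 : ℂ)‖ := hz
      norm_num at hz
    exact ((h1 _ (conj_inv_mem_disk hz)).comp z (differentiableAt_inv hz0)).differentiableWithinAt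
  · rw [RCLike.norm_conj]
    exact hC _ (conj_inv_mem_disk hz)
  · have h2 : DifferentiableOn ℂ (conj ∘ F ∘ conj) disk := fun z hz =>
      (h1 z (by rw [disk, mem_ofPred_eq, RCLike.norm_conj]; exact hz)).differentiableWithinAt
    exact analyticOnNhd_disk h2 0 zero_mem_disk

lemma holomorphicAtInfty_reflection {F : ℂ → ℂ} (hF : BoundedHolomorphicOn F disk) :
    HolomorphicAtInfty (fun z => conj (F (conj z⁻¹))) := by
  refine ⟨conj (F (conj 0)), ?_⟩
  have : Function.update (fun w : ℂ => conj (F (conj (w⁻¹)⁻¹))) 0 (conj (F (conj 0))) =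
      fun z => conj (F (conj z)) := by
    funext z
    rcases eq_or_ne z 0 with rfl | h <;> simp [*]
  rw [this]
  exact (boundedHolomorphicOn_reflection hF).2

lemma IsBoundaryQuotient.exists_isOuterBoundary {b : Circle → ℂ}
    (hb : IsBoundaryQuotient fun t => conj (b t)) (hbm : Measurable b) :
    ∃ k, NMExterior k ∧ IsOuterBoundary k b := by
  obtain ⟨f, g, p, q, hf, hg, ⟨z, hz, hgz⟩, hp, hq, e⟩ := hb
  have hg0 : ∃ z ∈ disk, g z ≠ 0 := ⟨z, hz, hgz⟩
  have hF := boundedHolomorphicOn_reflection hf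
  have hG := boundedHolomorphicOn_reflection hg
  refine ⟨fun z => conj (f (conj z⁻¹)) / conj (g (conj z⁻¹)), ⟨?_, ?_, _, _, hF.1,
    holomorphicAtInfty_reflection hf, hG.1, holomorphicAtInfty_reflection hg, ?_,
    fun _ _ _ => rfl⟩, hbm, ?_⟩
  · exact ((hF.1.1.analyticOnNhd isOpen_exterior).meromorphicOn).div
      ((hG.1.1.analyticOnNhd isOpen_exterior).meromorphicOn)
  · simp only [inv_inv]
    exact hF.2.meromorphicAt.div hG.2.meromorphicAt
  · obtain ⟨t, h1⟩ := (ae_forall_radius_ne_zero hg.1 hg0).exists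
    have h2 := h1 (1 / 2) (by norm_num) (by norm_num)
    set w : ℂ := ((1 / 2 : ℝ) : ℂ) * t with hw
    have hwd : w ∈ disk := mul_circle_mem_disk (by norm_num) (by norm_num) t
    have hw0 : w ≠ 0 := mul_ne_zero (by norm_num) (Circle.coe_ne_zero t)
    refine ⟨(conj w)⁻¹, inv_mem_exterior (by
      rw [disk, mem_ofPred_eq, RCLike.norm_conj]; exact hwd) (by simpa using hw0), ?_⟩
    simpa using h2
  · filter_upwards [hp.2, hq.2, (hg.integrable_log_boundary hg0 hq).1, e] with t h1 h2 h3 h4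
    have h5 := (Complex.continuous_conj.tendsto _).comp ((h1.div h2 h3).comp tendsto_inv_nhdsGT_one)
    have h6 : conj (p t / q t) = b t := by rw [← h4, Complex.conj_conj]
    rw [h6] at h5
    refine h5.congr fun r => ?_
    have h7 : conj ((r : ℂ) * t)⁻¹ = (r⁻¹ : ℝ) * t := by
      rw [map_inv₀, conj_mul_circle_inv]
    simp only [Function.comp_apply, Pi.div_apply, h7, map_div₀]

/-- A function has a pseudocontinuation if and only if it is of bounded type and the complex
conjugate of its boundary function is again the boundary function of a function of bounded type in
the disk. -/
theorem pseudocontinuable_iff {h : ℂ → ℂ} {b : Circle → ℂ} (hb : IsInnerBoundary h b) :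
    Pseudocontinuable h ↔ NMDisk h ∧ IsBoundaryQuotient fun t => conj (b t) := by
  refine and_congr_right fun hh => ⟨?_, fun h => ?_⟩
  · rintro ⟨k, hk, b', c, hb', hc, e⟩
    refine (hk.isBoundaryQuotient_conj hc).congr ?_
    filter_upwards [e, hb.ae_unique hb'] with t h1 h2
    rw [h2, h1]
  · obtain ⟨k, hk, hk'⟩ := h.exists_isOuterBoundary hb.1
    exact ⟨k, hk, b, b, hb, hk', ae_eq_rfl⟩

/-! ### Herglotz transforms and the Szegő function -/

/-- The Herglotz transform of a measure on the circle. -/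
def herglotz (ν : Measure Circle) (z : ℂ) : ℂ :=
  ∫ t : Circle, ((t : ℂ) + z) / ((t : ℂ) - z) ∂ν

lemma continuous_herglotzKernel {z : ℂ} (hz : z ∈ disk) :
    Continuous fun t : Circle => ((t : ℂ) + z) / ((t : ℂ) - z) :=
  Continuous.div (by fun_prop) (by fun_prop) (sub_ne_zero_of_disk hz)

lemma integrable_herglotzKernel (ν : Measure Circle) [IsFiniteMeasure ν] {z : ℂ} (hz : z ∈ disk) :
    Integrable (fun t : Circle => ((t : ℂ) + z) / ((t : ℂ) - z)) ν :=
  (continuous_herglotzKernel hz).integrable_of_hasCompactSupport (HasCompactSupport.of_compactSpace _)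

lemma re_herglotz (ν : Measure Circle) [IsFiniteMeasure ν] {z : ℂ} (hz : z ∈ disk) :
    (herglotz ν z).re = ∫ t : Circle, poissonKernel 0 z t ∂ν := by
  rw [herglotz, ← Complex.reCLM_apply,
    ← Complex.reCLM.integral_comp_comm (integrable_herglotzKernel ν hz)]
  refine integral_congr_ae (Eventually.of_forall fun t => ?_)
  simp [poissonKernel_eq_re_herglotzRieszKernel, herglotzRieszKernel]

lemma re_herglotz_nonneg (ν : Measure Circle) [IsFiniteMeasure ν] {z : ℂ} (hz : z ∈ disk) :
    0 ≤ (herglotz ν z).re := by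
  rw [re_herglotz ν hz]
  refine integral_nonneg fun t => ?_
  have hz : ‖z‖ < 1 := hz
  simp only [poissonKernel, sub_zero, Circle.norm_coe, Pi.zero_apply]
  have : 0 ≤ (1 : ℝ) ^ 2 - ‖z‖ ^ 2 := by nlinarith [norm_nonneg z]
  positivity

lemma differentiableOn_herglotz (ν : Measure Circle) [IsFiniteMeasure ν] :
    DifferentiableOn ℂ (herglotz ν) disk := by
  intro z₀ hz₀
  have hz₀' : ‖z₀‖ < 1 := hz₀
  set ε := (1 - ‖z₀‖) / 2 with hε
  have hε0 : 0 < ε := by linarith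
  have hsub : ∀ z ∈ ball z₀ ε, z ∈ disk ∧ ∀ t : Circle, ε ≤ ‖(t : ℂ) - z‖ := by
    intro z hz
    rw [mem_ball, dist_eq_norm] at hz
    have h1 : ‖z‖ ≤ ‖z₀‖ + ‖z - z₀‖ := by
      simpa using norm_add_le z₀ (z - z₀)
    refine ⟨show ‖z‖ < 1 by linarith, fun t => ?_⟩
    have h2 := norm_sub_norm_le (t : ℂ) z
    rw [Circle.norm_coe] at h2
    linarith
  refine (hasDerivAt_integral_of_dominated_loc_of_deriv_le
    (F := fun z (t : Circle) => ((t : ℂ) + z) / ((t : ℂ) - z))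
    (F' := fun z (t : Circle) => 2 * (t : ℂ) / ((t : ℂ) - z) ^ 2) (bound := fun _ => 2 / ε ^ 2)
    (ball_mem_nhds z₀ hε0) ?_ (integrable_herglotzKernel ν hz₀) ?_ ?_ (integrable_const _)
    ?_).2.differentiableAt.differentiableWithinAt
  · filter_upwards [ball_mem_nhds z₀ hε0] with z hz
    exact (continuous_herglotzKernel (hsub z hz).1).aestronglyMeasurable
  · refine (Continuous.div (by fun_prop) (by fun_prop) fun t => ?_).aestronglyMeasurable
    exact pow_ne_zero 2 (sub_ne_zero_of_disk hz₀ t)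
  · refine Eventually.of_forall fun t z hz => ?_
    have h1 := (hsub z hz).2 t
    rw [norm_div, norm_mul, norm_pow, Circle.norm_coe, mul_one, Complex.norm_ofNat]
    gcongr
  · refine Eventually.of_forall fun t z hz => ?_
    have h1 := sub_ne_zero_of_disk (hsub z hz).1 t
    have h2 : HasDerivAt (fun x => ((t : ℂ) + x) / ((t : ℂ) - x))
        ((1 * ((t : ℂ) - z) - ((t : ℂ) + z) * -1) / ((t : ℂ) - z) ^ 2) z :=
      ((hasDerivAt_id z).const_add (t : ℂ)).div ((hasDerivAt_id z).const_sub (t : ℂ)) h1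
    rwa [show 1 * ((t : ℂ) - z) - ((t : ℂ) + z) * -1 = 2 * t by ring] at h2

/-- The bounded holomorphic function `exp (-H / 2)`, `H` being the Herglotz transform of `ν`. -/
def expHerglotz (ν : Measure Circle) (z : ℂ) : ℂ := Complex.exp (-(1 / 2 : ℂ) * herglotz ν z)

lemma norm_expHerglotz (ν : Measure Circle) (z : ℂ) :
    ‖expHerglotz ν z‖ = Real.exp (-(1 / 2) * (herglotz ν z).re) := by
  rw [expHerglotz, Complex.norm_exp]
  congr 1
  have : (-(1 / 2) : ℂ) = ((-(1 / 2) : ℝ) : ℂ) := by push_cast; rfl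
  rw [this, Complex.re_ofReal_mul]

lemma boundedHolomorphicOn_expHerglotz (ν : Measure Circle) [IsFiniteMeasure ν] :
    BoundedHolomorphicOn (expHerglotz ν) disk := by
  refine ⟨((differentiableOn_herglotz ν).const_mul _).cexp, 1, fun z hz => ?_⟩
  rw [norm_expHerglotz, Real.exp_le_one_iff]
  linarith [re_herglotz_nonneg ν hz]

lemma measurable_log_density (μ : Measure Circle) :
    Measurable fun t => Real.log (density μ t) :=
  Real.measurable_log.comp (Measure.measurable_rnDeriv μ m).ennreal_toReal

lemma integral_mul_ofReal {L : Circle → ℝ} (hLm : Measurable L) (hL : Integrable L m)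
    {k : Circle → ℂ} (hk : Continuous k) :
    ∫ t, k t * (L t : ℂ) ∂m = ∫ t, k t ∂(m.withDensity fun t => ENNReal.ofReal (L t))
      - ∫ t, k t ∂(m.withDensity fun t => ENNReal.ofReal (-L t)) := by
  have hLn : Measurable fun t => -L t := hLm.neg
  have hki : ∀ (ν : Measure Circle) [IsFiniteMeasure ν], Integrable k ν := fun ν _ =>
    hk.integrable_of_hasCompactSupport (HasCompactSupport.of_compactSpace _)
  have h1 : IsFiniteMeasure (m.withDensity fun t => ENNReal.ofReal (L t)) :=
    isFiniteMeasure_withDensity_ofReal hL.2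
  have h2 : IsFiniteMeasure (m.withDensity fun t => ENNReal.ofReal (-L t)) :=
    isFiniteMeasure_withDensity_ofReal hL.neg.2
  have i1 : Integrable (fun t => (ENNReal.ofReal (L t)).toReal • k t) m :=
    (integrable_withDensity_iff_integrable_smul' hLm.ennreal_ofReal
    (Eventually.of_forall fun _ => ENNReal.ofReal_lt_top)).1
      (hki (m.withDensity _))
  have i2 : Integrable (fun t => (ENNReal.ofReal (-L t)).toReal • k t) m :=
    (integrable_withDensity_iff_integrable_smul' hLn.ennreal_ofReal
    (Eventually.of_forall fun _ => ENNReal.ofReal_lt_top)).1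
      (hki (m.withDensity _))
  rw [integral_withDensity_eq_integral_toReal_smul hLm.ennreal_ofReal
    (Eventually.of_forall fun _ => ENNReal.ofReal_lt_top),
    integral_withDensity_eq_integral_toReal_smul hLn.ennreal_ofReal
    (Eventually.of_forall fun _ => ENNReal.ofReal_lt_top), ← integral_sub i1 i2]
  refine integral_congr_ae (Eventually.of_forall fun t => ?_)
  simp only [Complex.real_smul, ENNReal.toReal_ofReal', ← sub_mul, ← Complex.ofReal_sub]
  rw [mul_comm, max_zero_sub_max_neg_zero_eq_self]

variable {μ : Measure Circle}

/-- The positive part of the measure `log w dm`. -/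
def logPos (μ : Measure Circle) : Measure Circle :=
  m.withDensity fun t => ENNReal.ofReal (Real.log (density μ t))

/-- The negative part of the measure `log w dm`. -/
def logNeg (μ : Measure Circle) : Measure Circle :=
  m.withDensity fun t => ENNReal.ofReal (-Real.log (density μ t))

lemma SzegoCondition.isFiniteMeasure_logPos (h : SzegoCondition μ) : IsFiniteMeasure (logPos μ) :=
  isFiniteMeasure_withDensity_ofReal h.2.2

lemma SzegoCondition.isFiniteMeasure_logNeg (h : SzegoCondition μ) : IsFiniteMeasure (logNeg μ) :=
  isFiniteMeasure_withDensity_ofReal h.2.neg.2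

/-- Splitting log w into positive and negative parts writes D as a quotient of two functions exp (-H
/ 2) with Re H ≥ 0, each bounded by 1; this shows that D is of bounded type. -/
lemma SzegoCondition.szegoFunction_eq (h : SzegoCondition μ) {z : ℂ} (hz : z ∈ disk) :
    szegoFunction μ z = expHerglotz (logNeg μ) z / expHerglotz (logPos μ) z := by
  rw [szegoFunction, integral_mul_ofReal (measurable_log_density μ) h.2
    (continuous_herglotzKernel hz), expHerglotz, expHerglotz, ← Complex.exp_sub]
  simp only [herglotz, logPos, logNeg]
  congr 1
  ring

lemma SzegoCondition.nmDisk_szegoFunction (h : SzegoCondition μ) : NMDisk (szegoFunction μ) := by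
  have := h.isFiniteMeasure_logPos
  have := h.isFiniteMeasure_logNeg
  have h1 := boundedHolomorphicOn_expHerglotz (logNeg μ)
  have h2 := boundedHolomorphicOn_expHerglotz (logPos μ)
  have hd : DifferentiableOn ℂ (szegoFunction μ) disk :=
    (h1.1.div h2.1 fun z _ => Complex.exp_ne_zero _).congr fun z hz => h.szegoFunction_eq hz
  exact ⟨(analyticOnNhd_disk hd).meromorphicOn, _, _, h1, h2,
    ⟨0, zero_mem_disk, Complex.exp_ne_zero _⟩, fun z hz _ => h.szegoFunction_eq hz⟩

/-- log |D|² is the Poisson integral of log w dm, so Fatou's theorem for its positive and negative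
parts gives radial limit log w a.e. -/
lemma SzegoCondition.ae_normSq_boundary (h : SzegoCondition μ) {d : Circle → ℂ}
    (hd : IsInnerBoundary (szegoFunction μ) d) : ∀ᵐ t ∂m, ‖d t‖ ^ 2 = density μ t := by
  have := h.isFiniteMeasure_logPos
  have := h.isFiniteMeasure_logNeg
  have hLn : Measurable fun t => -Real.log (density μ t) := (measurable_log_density μ).neg
  filter_upwards [hd.2, h.1, ae_tendsto_integral_poissonKernel (logPos μ),
    ae_tendsto_integral_poissonKernel (logNeg μ),
    Measure.rnDeriv_withDensity m (measurable_log_density μ).ennreal_ofReal,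
    Measure.rnDeriv_withDensity m hLn.ennreal_ofReal]
    with t h1 h2 h3 h4 h5 h6
  rw [logPos, h5] at h3
  rw [logNeg, h6] at h4
  have h7 := (Real.continuous_exp.tendsto _).comp (h3.sub h4)
  rw [ENNReal.toReal_ofReal', ENNReal.toReal_ofReal', max_zero_sub_max_neg_zero_eq_self,
    Real.exp_log h2] at h7
  refine tendsto_nhds_unique (h1.norm.pow 2) (h7.congr' ?_)
  filter_upwards [eventually_mem_Ioo] with r hr
  have hz := mul_circle_mem_disk hr.1 hr.2 t
  rw [Function.comp_apply, h.szegoFunction_eq hz, norm_div, norm_expHerglotz, norm_expHerglotz,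
    ← Real.exp_sub, ← Real.exp_nat_mul, re_herglotz _ hz, re_herglotz _ hz]
  congr 1
  simp only [logPos, logNeg]
  push_cast
  ring

/-! ### The boundary identity and the two implications -/

lemma re_cayley_mul_normSq {a : ℂ} (ha : 1 - a ≠ 0) :
    ((1 + a) / (1 - a)).re * ‖1 - a‖ ^ 2 = 1 - ‖a‖ ^ 2 := by
  have h : Complex.normSq (1 - a) ≠ 0 := by simpa using ha
  rw [Complex.div_re, ← Complex.normSq_eq_norm_sq, ← Complex.normSq_eq_norm_sq, ← add_div,
    div_mul_cancel₀ _ h]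
  simp [Complex.normSq_apply]
  ring

/-- Inside the disk this is the formula for the real part of the Cayley transform of ζΘ(ζ); Fatou's
theorem takes it to the boundary. The product form is needed because 1 - tθ is not yet known to be
nonzero. -/
lemma IsAssociated.ae_density_mul {Θ : ℂ → ℂ} {θ : Circle → ℂ} (hΘ : IsSchur Θ)
    (hμ : IsAssociated Θ μ) (hθ : IsInnerBoundary Θ θ) :
    ∀ᵐ t : Circle ∂m, density μ t * ‖1 - (t : ℂ) * θ t‖ ^ 2 = 1 - ‖θ t‖ ^ 2 := by
  have := hμ.1
  filter_upwards [hθ.2, ae_tendsto_integral_poissonKernel μ] with t h1 h2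
  have h3 : Tendsto (fun r : ℝ => ((r : ℂ) * t) * Θ (r * t)) (𝓝[<] 1) (𝓝 ((t : ℂ) * θ t)) :=
    (tendsto_mul_nhdsLT _).mul h1
  have h4 := h2.mul ((h3.const_sub 1).norm.pow 2)
  have h5 := (h3.norm.pow 2).const_sub 1
  rw [norm_mul, Circle.norm_coe, one_mul] at h5
  refine tendsto_nhds_unique h4 (h5.congr' ?_)
  filter_upwards [eventually_mem_Ioo] with r hr
  have hz := mul_circle_mem_disk hr.1 hr.2 t
  have hlt : ‖((r : ℂ) * t) * Θ (r * t)‖ < 1 := by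
    rw [norm_mul]
    have : ‖(r : ℂ) * t‖ < 1 := hz
    nlinarith [hΘ.2 _ hz, norm_nonneg (Θ (r * t)), norm_nonneg ((r : ℂ) * t)]
  rw [← re_herglotz μ hz, herglotz, ← hμ.2 _ hz, re_cayley_mul_normSq]
  intro h
  rw [sub_eq_zero] at h
  rw [← h, norm_one] at hlt
  exact lt_irrefl _ hlt

lemma IsSchur.boundedHolomorphicOn {Θ : ℂ → ℂ} (hΘ : IsSchur Θ) : BoundedHolomorphicOn Θ disk :=
  ⟨hΘ.1, 1, hΘ.2⟩

lemma IsSchur.nmDisk {Θ : ℂ → ℂ} (hΘ : IsSchur Θ) : NMDisk Θ :=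
  ⟨(analyticOnNhd_disk hΘ.1).meromorphicOn, Θ, fun _ => 1, hΘ.boundedHolomorphicOn,
    boundedHolomorphicOn_const 1 _, ⟨0, zero_mem_disk, one_ne_zero⟩, fun _ _ _ => by simp⟩

lemma ofReal_density_mul_mul_conj {w : ℝ} {t : Circle} {a : ℂ}
    (h : w * ‖1 - (t : ℂ) * a‖ ^ 2 = 1 - ‖a‖ ^ 2) :
    (w : ℂ) * (1 - t * a) * (1 - (t : ℂ)⁻¹ * conj a) = 1 - a * conj a := by
  have h1 : conj (1 - (t : ℂ) * a) = 1 - (t : ℂ)⁻¹ * conj a := by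
    rw [map_sub, map_one, map_mul, ← Circle.coe_inv_eq_conj, Circle.coe_inv]
  rw [← h1, mul_assoc, Complex.mul_conj, Complex.mul_conj, Complex.normSq_eq_norm_sq,
    Complex.normSq_eq_norm_sq]
  exact_mod_cast h

theorem szego_of_pseudocontinuable {Θ : ℂ → ℂ} (hΘ : IsSchur Θ) (hinner : ¬ IsInner Θ)
    (hμ : IsAssociated Θ μ) (h : Pseudocontinuable Θ) :
    SzegoCondition μ ∧ Pseudocontinuable (szegoFunction μ) := by
  obtain ⟨θ, hθ, qθ⟩ := hΘ.nmDisk.exists_isInnerBoundary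
  have qθ' := ((pseudocontinuable_iff hθ).1 h).2
  have hw := hμ.ae_density_mul hΘ hθ
  have qu : IsBoundaryQuotient fun t => 1 - θ t * conj (θ t) :=
    (IsBoundaryQuotient.const 1).sub (qθ.mul qθ')
  have qv : IsBoundaryQuotient fun t => 1 - (t : ℂ) * θ t :=
    (IsBoundaryQuotient.const 1).sub (IsBoundaryQuotient.coe.mul qθ)
  have qv' : IsBoundaryQuotient fun t => 1 - (t : ℂ)⁻¹ * conj (θ t) :=
    (IsBoundaryQuotient.const 1).sub (IsBoundaryQuotient.coe.inv.mul qθ')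
  have hu : ∀ t, (1 : ℂ) - θ t * conj (θ t) = ((1 - ‖θ t‖ ^ 2 : ℝ) : ℂ) := fun t => by
    rw [Complex.mul_conj, Complex.normSq_eq_norm_sq]; push_cast; rfl
  have hu0 : ¬ ∀ᵐ t ∂m, (1 : ℂ) - θ t * conj (θ t) = 0 := by
    intro h0
    refine hinner ⟨hΘ, θ, hθ, ?_⟩
    filter_upwards [h0] with t ht
    rw [hu, Complex.ofReal_eq_zero, sub_eq_zero] at ht
    exact (pow_eq_one_iff_of_nonneg (norm_nonneg _) two_ne_zero).1 ht.symm
  obtain ⟨u1, u2⟩ := qu.integrable_log hu0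
  -- Were 1 - tθ zero a.e., the boundary identity would force 1 - |θ|² = 0 a.e.
  have hv0 : ¬ ∀ᵐ t : Circle ∂m, (1 : ℂ) - t * θ t = 0 := by
    intro h0
    obtain ⟨t, h1, h2, h3⟩ := (h0.and (hw.and u1)).exists
    rw [h1, norm_zero] at h2
    apply h3
    rw [hu, ← h2]
    simp
  obtain ⟨v1, v2⟩ := qv.integrable_log hv0
  have hnorm : ∀ᵐ t : Circle ∂m, density μ t = ‖1 - θ t * conj (θ t)‖ / ‖1 - (t : ℂ) * θ t‖ ^ 2 := by
    filter_upwards [hw, v1] with t h1 h2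
    have h3 : 0 < ‖1 - (t : ℂ) * θ t‖ := norm_pos_iff.2 h2
    rw [eq_div_iff (by positivity), hu, Complex.norm_real, ← h1, Real.norm_eq_abs, abs_of_nonneg]
    exact mul_nonneg ENNReal.toReal_nonneg (by positivity)
  have hS : SzegoCondition μ := by
    refine ⟨?_, (u2.sub (v2.const_mul 2)).congr ?_⟩
    · filter_upwards [hnorm, u1, v1] with t h1 h2 h3
      have h4 := norm_pos_iff.2 h2
      have h5 := norm_pos_iff.2 h3
      rw [h1]
      positivity
    · filter_upwards [hnorm, u1, v1] with t h1 h2 h3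
      have h4 := norm_pos_iff.2 h2
      have h5 := norm_pos_iff.2 h3
      rw [h1, Real.log_div h4.ne' (by positivity), Real.log_pow]
      simp
  refine ⟨hS, ?_⟩
  obtain ⟨d, hd, qd⟩ := hS.nmDisk_szegoFunction.exists_isInnerBoundary
  refine (pseudocontinuable_iff hd).2 ⟨hS.nmDisk_szegoFunction, ?_⟩
  -- With w = d conj d, the identity reads conj d = (1 - θ conj θ) / ((1 - tθ)(1 - t⁻¹ conj θ) d).
  refine (qu.div ((qv.mul qv').mul qd)).congr ?_
  filter_upwards [hS.ae_normSq_boundary hd, hS.1, hw, u1] with t h1 h2 h3 h4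
  have h5 : d t ≠ 0 := by
    intro h0
    rw [h0, norm_zero] at h1
    norm_num at h1
    linarith
  have h6 := ofReal_density_mul_mul_conj h3
  have h7 : d t * conj (d t) = density μ t := by
    rw [Complex.mul_conj, Complex.normSq_eq_norm_sq, h1]
  rw [← h6] at h4 ⊢
  have h8 := right_ne_zero_of_mul h4
  have h9 := right_ne_zero_of_mul (left_ne_zero_of_mul h4)
  rw [eq_div_iff (mul_ne_zero (mul_ne_zero h9 h8) h5)]
  linear_combination (1 - (t : ℂ) * θ t) * (1 - (t : ℂ)⁻¹ * conj (θ t)) * h7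

theorem pseudocontinuable_of_szego {Θ : ℂ → ℂ} (hΘ : IsSchur Θ) (hμ : IsAssociated Θ μ)
    (hS : SzegoCondition μ) (h : Pseudocontinuable (szegoFunction μ)) : Pseudocontinuable Θ := by
  obtain ⟨θ, hθ, qθ⟩ := hΘ.nmDisk.exists_isInnerBoundary
  obtain ⟨d, hd, qd⟩ := hS.nmDisk_szegoFunction.exists_isInnerBoundary
  have qd' := ((pseudocontinuable_iff hd).1 h).2
  have qwv : IsBoundaryQuotient fun t => d t * conj (d t) * (1 - t * θ t) :=
    (qd.mul qd').mul ((IsBoundaryQuotient.const 1).sub (IsBoundaryQuotient.coe.mul qθ))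
  refine (pseudocontinuable_iff hθ).2 ⟨hΘ.nmDisk, ?_⟩
  -- Solving the identity for conj θ gives (w(1 - tθ) - 1) / (w(1 - tθ)t⁻¹ - θ).
  refine ((qwv.sub (IsBoundaryQuotient.const 1)).div
    ((qwv.mul IsBoundaryQuotient.coe.inv).sub qθ)).congr ?_
  filter_upwards [hS.ae_normSq_boundary hd, hμ.ae_density_mul hΘ hθ] with t h1 h3
  have h6 := ofReal_density_mul_mul_conj h3
  have h7 : d t * conj (d t) = density μ t := by
    rw [Complex.mul_conj, Complex.normSq_eq_norm_sq, h1]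
  rw [h7]
  have ht := Circle.coe_ne_zero t
  have hmain : (density μ t : ℂ) * (1 - t * θ t) - 1 =
      conj (θ t) * ((density μ t : ℂ) * (1 - t * θ t) * (t : ℂ)⁻¹ - θ t) := by
    linear_combination h6
  -- If the denominator vanished, the identity would give w(1 - tθ) = 1, hence θ = t⁻¹ and 1 - tθ =
  -- 0, a contradiction.
  refine eq_div_of_mul_eq (fun h0 => ?_) hmain.symm
  rw [h0, mul_zero, sub_eq_zero] at hmain
  rw [hmain, one_mul, sub_eq_zero] at h0
  rw [← h0, mul_inv_cancel₀ ht, sub_self, mul_zero] at hmain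
  exact zero_ne_one hmain

end Pseudocontinuation

end

theorem theorem3p9 (Θ : ℂ → ℂ) (hΘ : Pseudocontinuation.IsSchur Θ)
    (hinner : ¬ Pseudocontinuation.IsInner Θ)
    (μ : MeasureTheory.Measure Circle) (hμ : Pseudocontinuation.IsAssociated Θ μ) :
    Pseudocontinuation.Pseudocontinuable Θ ↔
      (Pseudocontinuation.SzegoCondition μ ∧
        Pseudocontinuation.Pseudocontinuable (Pseudocontinuation.szegoFunction μ)) :=
  ⟨Pseudocontinuation.szego_of_pseudocontinuable hΘ hinner hμ,
    fun h => Pseudocontinuation.pseudocontinuable_of_szego hΘ hμ h.1 h.2⟩
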